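/- **HFL.** Fix a finite set $\mathcal A$ of actions and countably infinite sets of atomic propositions and of variables, both given by names that are finite binary words. *Types* are the ground type $\mathsf{Pr}$ and $\sigma^v\to\tau$ for types $\sigma,\tau$ and a variance $v\in\{+,-,0\}$. *Formulas* are $$\varphi ::= q \mid X \mid \neg\varphi \mid \varphi\vee\varphi \mid \langle a\rangle\varphi \mid \varphi\,\varphi \mid \lambda(X^v:\tau).\varphi \mid \mu(X:\tau).\varphi .$$ The *complement* exchanges $+$ and $-$ and keeps $0$; $\Gamma^-$ complements all variances of a context $\Gamma=X_1^{v_1}:\tau_1,\dots,X_n^{v_n}:\tau_n$ (with distinct $X_i$). The typing rules are: $\Gamma\vdash q:\mathsf{Pr}$; $\Gamma,X^v:\tau\vdash X:\tau$ for $v\in\{0,+\}$; $\Gamma\vdash\neg\varphi:\tau$ if $\Gamma^-\vdash\varphi:\tau$; $\Gamma\vdash\varphi\vee\psi:\mathsf{Pr}$ if $\Gamma\vdash\varphi:\mathsf{Pr}$ and $\Gamma\vdash\psi:\mathsf{Pr}$; $\Gamma\vdash\langle a\rangle\varphi:\mathsf{Pr}$ if $\Gamma\vdash\varphi:\mathsf{Pr}$;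 $\Gamma\vdash\lambda(X^v:\sigma).\varphi:\sigma^v\to\tau$ if $\Gamma,X^v:\sigma\vdash\varphi:\tau$; $\Gamma\vdash\mu(X:\tau).\varphi:\tau$ if $\Gamma,X^+:\tau\vdash\varphi:\tau$; and $\Gamma\vdash\varphi\,\psi:\tau$ if $\Gamma\vdash\varphi:\sigma^v\to\tau$ and, moreover, $\Gamma\vdash\psi:\sigma$ when $v\in\{+,0\}$, and $\Gamma^-\vdash\psi:\sigma$ when $v\in\{-,0\}$. Write a type, ignoring variances, as $\tau=\tau_1\to\dots\to\tau_r\to\mathsf{Pr}$. Its *order* is $\mathrm{ord}(\tau)=\max\{1+\mathrm{ord}(\tau_i)\mid 1\le i\le r\}$ (with $\max\emptyset=0$) and its *maximal arity* is $\mathrm{mar}(\tau)=\max(\{r\}\cup\{\mathrm{mar}(\tau_i)\mid 1\le i\le r\})$. $\mathrm{HFL}(k,m)$ is the set of formulas $\varphi$ such that $\vdash\varphi:\mathsf{Pr}$ (in the empty context) is derivable using only types of order at most $k$ and maximal arity at most $m$. **Semantics.** A *transition system* $\mathcal T$ consists of a finite set $\mathcal S$ of states, a relation $\xrightarrow{a}$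 on $\mathcal S$ for each $a\in\mathcal A$, and a finite set $L(s)$ of atomic propositions for each $s\in\mathcal S$. Put $[\![\mathsf{Pr}]\!]=(2^{\mathcal S},\subseteq)$, and let $[\![\sigma^v\to\tau]\!]$ be the set of monotone functions from $[\![\sigma]\!]^v$ to $[\![\tau]\!]$, ordered pointwise, where $[\![\sigma]\!]^+$ is $[\![\sigma]\!]$, $[\![\sigma]\!]^-$ carries the reversed order, and $[\![\sigma]\!]^0$ the intersection of the order with its reverse. For an environment $\eta$ (a partial map from variables to elements of such lattices), the value $[\![\varphi]\!]_\eta$ of $\varphi$ at a type is given by: $[\![q]\!]_\eta=\{s\mid q\in L(s)\}$; $[\![X]\!]_\eta=\eta(X)$; $[\![\neg\varphi]\!]_\eta$ is the element $f$ of $[\![\tau]\!]$ that is the complement of $[\![\varphi]\!]_\eta$, complements being taken in $\mathcal S$ for $\tau=\mathsf{Pr}$ and pointwise for function types; $[\![\varphi\vee\psi]\!]_\eta=[\![\varphi]\!]_\eta\cup[\![\psi]\!]_\eta$; $[\![\langle a\rangle\varphi]\!]_\eta=\{s\mid s\xrightarrow{a}t\text{ for some }t\in[\![\varphi]\!]_\eta\}$;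 $[\![\lambda(X^v:\sigma).\varphi]\!]_\eta$, where $\varphi$ is taken at type $\tau$, is the $f\in[\![\sigma^v\to\tau]\!]$ with $f\,x=[\![\varphi]\!]_{\eta[X\mapsto x]}$ for all $x\in[\![\sigma]\!]$; $[\![\varphi\,\psi]\!]_\eta=[\![\varphi]\!]_\eta\,[\![\psi]\!]_\eta$; and $[\![\mu(X:\tau).\varphi]\!]_\eta=\bigsqcap\{x\in[\![\tau]\!]\mid[\![\varphi]\!]_{\eta[X\mapsto x]}\sqsubseteq x\}$. A clause gives no value if a value that it refers to (for $\lambda$ and $\mu$: for some $x$) does not exist or if no element of the required kind exists; this can happen only for formulas that contain negations at function types. Write $\mathcal T,s\models\varphi$ if $\varphi$ has a value in the empty environment at type $\mathsf{Pr}$ and $s$ belongs to it. **Theorem.** Let $k,m\ge 1$ and let $\mathcal T$ be a fixed transition system. Then the model checking problem for $\mathrm{HFL}(k,m)$ on $\mathcal T$, $$\{(s,\varphi)\mid s\in\mathcal S,\ \varphi\in\mathrm{HFL}(k,m),\ \mathcal T,s\models\varphi\},$$ where $\varphi$ is written as a word in prefix notation over a finite alphabet, is in $\mathrm{EXPTIME}$: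 there are a polynomial $p$ and a deterministic Turing machine that decides this language and halts after at most $2^{p(n)}$ steps on every input word of length $n$. -/

import Mathlib

namespace HFL

/-! ### Types, formulas, typing -/

/-- Variances `+`, `-`, `0`. -/
inductive Variance where
  | pos | neg | zero

/-- The complement of a variance: `+` and `-` are swapped, `0` is kept. -/
def Variance.compl : Variance → Variance
  | .pos => .neg
  | .neg => .pos
  | .zero => .zero

/-- HFL types: the ground type `Pr` and function types `σ^v → τ`. -/
inductive Ty where
  | pr : Ty
  | fn (σ : Ty) (v : Variance) (τ : Ty) : Ty

/-- The number `m` of arguments of `τ = τ₁ → ⋯ → τ_m → Pr`. -/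
def Ty.arity : Ty → ℕ
  | .pr => 0
  | .fn _ _ τ => τ.arity + 1

/-- The order of a type, `ord (τ₁ → ⋯ → τ_m → Pr) = max {1 + ord τᵢ}` with `max ∅ = 0`. -/
def Ty.order : Ty → ℕ
  | .pr => 0
  | .fn σ _ τ => max (1 + σ.order) τ.order

/-- The maximal arity of a type,
`mar (τ₁ → ⋯ → τ_m → Pr) = max ({m} ∪ {mar τᵢ})`. -/
def Ty.maxArity : Ty → ℕ
  | .pr => 0
  | .fn σ v τ => max (Ty.fn σ v τ).arity (max σ.maxArity τ.maxArity)

/-- The types of order at most `k` and maximal arity at most `m`. -/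
def Types (k m : ℕ) : Set Ty := {τ | τ.order ≤ k ∧ τ.maxArity ≤ m}

/-- Names of variables and of atomic propositions: finite binary words. -/
abbrev Name : Type := List Bool

/-- HFL formulas over the set `A` of actions. -/
inductive Formula (A : Type) where
  | prop (q : Name) : Formula A
  | var (X : Name) : Formula A
  | neg (φ : Formula A) : Formula A
  | or (φ ψ : Formula A) : Formula A
  | dia (a : A) (φ : Formula A) : Formula A
  | app (φ ψ : Formula A) : Formula A
  | lam (X : Name) (v : Variance) (σ : Ty) (φ : Formula A) : Formula A
  | mu (X : Name) (τ : Ty) (φ : Formula A) : Formula A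

/-- A context assigns a variance and a type to some of the variables; `none` means that the
variable does not occur in the context. -/
abbrev Ctx : Type := Name → Option (Variance × Ty)

/-- The empty context. -/
def Ctx.empty : Ctx := fun _ => none

/-- The complement `Γ⁻` of a context: every variance is replaced by its complement. -/
def Ctx.compl (Γ : Ctx) : Ctx := fun X => (Γ X).map fun p => (p.1.compl, p.2)

/-- The context `Γ, X^v : τ`; it is only used for a variable `X` not occurring in `Γ`. -/
def Ctx.extend (Γ : Ctx) (X : Name) (v : Variance) (τ : Ty) : Ctx :=
  Function.update Γ X (some (v, τ))

/-- `HasType U Γ φ τ`: the judgement `Γ ⊢ φ : τ` has a derivation in which every formula is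
assigned a type from `U`. The variables of a context are pairwise distinct, so a bound
variable must be new to the context. -/
inductive HasType {A : Type} (U : Set Ty) : Ctx → Formula A → Ty → Prop
  | prop {Γ : Ctx} {q : Name} :
      Ty.pr ∈ U → HasType U Γ (.prop q) .pr
  | var {Γ : Ctx} {X : Name} {v : Variance} {τ : Ty} :
      τ ∈ U → Γ X = some (v, τ) → (v = .zero ∨ v = .pos) → HasType U Γ (.var X) τ
  | neg {Γ : Ctx} {φ : Formula A} {τ : Ty} :
      τ ∈ U → HasType U Γ.compl φ τ → HasType U Γ (.neg φ) τ
  | or {Γ : Ctx} {φ ψ : Formula A} :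
      Ty.pr ∈ U → HasType U Γ φ .pr → HasType U Γ ψ .pr → HasType U Γ (.or φ ψ) .pr
  | dia {Γ : Ctx} {a : A} {φ : Formula A} :
      Ty.pr ∈ U → HasType U Γ φ .pr → HasType U Γ (.dia a φ) .pr
  | lam {Γ : Ctx} {X : Name} {v : Variance} {σ τ : Ty} {φ : Formula A} :
      Ty.fn σ v τ ∈ U → Γ X = none → HasType U (Γ.extend X v σ) φ τ →
      HasType U Γ (.lam X v σ φ) (.fn σ v τ)
  | appPos {Γ : Ctx} {φ ψ : Formula A} {σ τ : Ty} :
      τ ∈ U → HasType U Γ φ (.fn σ .pos τ) → HasType U Γ ψ σ → HasType U Γ (.app φ ψ) τ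
  | appNeg {Γ : Ctx} {φ ψ : Formula A} {σ τ : Ty} :
      τ ∈ U → HasType U Γ φ (.fn σ .neg τ) → HasType U Γ.compl ψ σ →
      HasType U Γ (.app φ ψ) τ
  | appZero {Γ : Ctx} {φ ψ : Formula A} {σ τ : Ty} :
      τ ∈ U → HasType U Γ φ (.fn σ .zero τ) → HasType U Γ ψ σ → HasType U Γ.compl ψ σ →
      HasType U Γ (.app φ ψ) τ
  | mu {Γ : Ctx} {X : Name} {τ : Ty} {φ : Formula A} :
      τ ∈ U → Γ X = none → HasType U (Γ.extend X .pos τ) φ τ → HasType U Γ (.mu X τ φ) τ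

/-- The fragment `HFL(k,m)`: the sentences of type `Pr` that are typable using only types of
order at most `k` and maximal arity at most `m`. -/
def Fragment (A : Type) (k m : ℕ) : Set (Formula A) :=
  {φ | HasType (Types k m) Ctx.empty φ .pr}

/-! ### Transition systems and semantics -/

/-- A labelled transition system with actions `A` and states `S`. Every state carries a finite
set of atomic propositions. -/
structure LTS (A S : Type) where
  trans : A → S → S → Prop
  label : S → Finset Name

/-- The set `C`, to be ordered according to a variance. -/
def VOrd (_v : Variance) (C : Type) : Type := C

/-- The order of `C` is kept for `+`, reversed for `-`, and for `0` intersected with its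
reverse. -/
instance VOrd.instPreorder (v : Variance) (C : Type) [Preorder C] : Preorder (VOrd v C) where
  le x y := match v with
    | .pos => (show C from x) ≤ (show C from y)
    | .neg => (show C from y) ≤ (show C from x)
    | .zero => (show C from x) ≤ (show C from y) ∧ (show C from y) ≤ (show C from x)
  le_refl x := by
    cases v
    · exact le_refl (α := C) x
    · exact le_refl (α := C) x
    · exact ⟨le_refl (α := C) x, le_refl (α := C) x⟩
  le_trans x y z h₁ h₂ := by
    cases v
    · exact le_trans (α := C) h₁ h₂
    · exact le_trans (α := C) h₂ h₁
    · exact ⟨le_trans (α := C) h₁.1 h₂.1, le_trans (α := C) h₂.2 h₁.2⟩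

/-- The complete lattice of a type over the state set `S`: the power set of `S` for `Pr`, and
for `σ^v → τ` the monotone functions from the `v`-ordered lattice of `σ` to the lattice of `τ`,
ordered pointwise. -/
noncomputable def lattice (S : Type) : Ty → (C : Type) × CompleteLattice C
  | .pr => ⟨Set S, inferInstance⟩
  | .fn σ v τ =>
      letI := (lattice S σ).2
      letI := (lattice S τ).2
      ⟨VOrd v (lattice S σ).1 →o (lattice S τ).1, inferInstance⟩

/-- The elements of the lattice of a type. -/
def Den (S : Type) (τ : Ty) : Type := (lattice S τ).1

noncomputable instance Den.instCompleteLattice (S : Type) (τ : Ty) : CompleteLattice (Den S τ) :=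
  (lattice S τ).2

/-- A set of states as an element of the lattice of `Pr`. -/
def Den.ofSet {S : Type} (D : Set S) : Den S .pr := D

/-- An element of the lattice of `Pr` as a set of states. -/
def Den.toSet {S : Type} (d : Den S .pr) : Set S := d

/-- An element of the lattice of `σ^v → τ` as a function. -/
def Den.apply {S : Type} {σ τ : Ty} {v : Variance} (f : Den S (.fn σ v τ)) (x : Den S σ) :
    Den S τ :=
  letI := (lattice S σ).2
  letI := (lattice S τ).2
  OrderHom.toFun (α := VOrd v (lattice S σ).1) (β := (lattice S τ).1) f x

/-- `IsComplement τ f d`: both elements belong to the lattice of `τ` and `f` is the complement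
of `d`. This is the complement in `S` for `Pr`, and is pointwise for function types. -/
def IsComplement {S : Type} : (τ : Ty) → Den S τ → Den S τ → Prop
  | .pr => fun f d => f.toSet = d.toSetᶜ
  | .fn σ _ τ => fun f d => ∀ x : Den S σ, IsComplement τ (f.apply x) (d.apply x)

/-- Environments: partial maps from variables to elements of the lattices of the types. -/
abbrev Env (S : Type) : Type := Name → Option ((τ : Ty) × Den S τ)

/-- The everywhere undefined environment. -/
def Env.empty (S : Type) : Env S := fun _ => none

/-- The environment `η[X ↦ x]`. -/
def Env.set {S : Type} (η : Env S) (X : Name) {τ : Ty} (x : Den S τ) : Env S :=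
  Function.update η X (some ⟨τ, x⟩)

/-- `Sem T η φ τ d`: the semantics of `φ`, as a formula of type `τ`, over `T` in the
environment `η` is `d`. The clauses for negation and for abstraction demand that the function
they describe is an element of the lattice of the type. -/
inductive Sem {A S : Type} (T : LTS A S) : Env S → Formula A → (τ : Ty) → Den S τ → Prop
  | prop {η : Env S} {q : Name} :
      Sem T η (.prop q) .pr (Den.ofSet {s | q ∈ T.label s})
  | var {η : Env S} {X : Name} {τ : Ty} {d : Den S τ} :
      η X = some ⟨τ, d⟩ → Sem T η (.var X) τ d
  | neg {η : Env S} {φ : Formula A} {τ : Ty} {d f : Den S τ} :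
      Sem T η φ τ d → IsComplement τ f d → Sem T η (.neg φ) τ f
  | or {η : Env S} {φ ψ : Formula A} {d e : Den S .pr} :
      Sem T η φ .pr d → Sem T η ψ .pr e →
      Sem T η (.or φ ψ) .pr (Den.ofSet (d.toSet ∪ e.toSet))
  | dia {η : Env S} {a : A} {φ : Formula A} {d : Den S .pr} :
      Sem T η φ .pr d →
      Sem T η (.dia a φ) .pr (Den.ofSet {s | ∃ t, T.trans a s t ∧ t ∈ d.toSet})
  | lam {η : Env S} {X : Name} {v : Variance} {σ τ : Ty} {φ : Formula A}
      {f : Den S (.fn σ v τ)} :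
      (∀ x : Den S σ, Sem T (η.set X x) φ τ (f.apply x)) →
      Sem T η (.lam X v σ φ) (.fn σ v τ) f
  | app {η : Env S} {φ ψ : Formula A} {v : Variance} {σ τ : Ty}
      {f : Den S (.fn σ v τ)} {x : Den S σ} :
      Sem T η φ (.fn σ v τ) f → Sem T η ψ σ x → Sem T η (.app φ ψ) τ (f.apply x)
  | mu {η : Env S} {X : Name} {τ : Ty} {φ : Formula A} {g : Den S τ → Den S τ} :
      (∀ x : Den S τ, Sem T (η.set X x) φ τ (g x)) →
      Sem T η (.mu X τ φ) τ (sInf {x | g x ≤ x})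

/-- `T, s ⊨ φ` for a sentence `φ` of type `Pr`. -/
def Satisfies {A S : Type} (T : LTS A S) (s : S) (φ : Formula A) : Prop :=
  ∃ d : Den S .pr, Sem T (Env.empty S) φ .pr d ∧ s ∈ d.toSet

/-! ### Words -/

/-- The alphabet for writing down pairs of a state and a formula. -/
inductive Letter (A S : Type) where
  | state (s : S)
  | prop | var | neg | or | dia (a : A) | app | lam (v : Variance) | mu
  | pr | arrow (v : Variance)
  | bit (b : Bool) | endName

/-- A name is written as its bits, followed by an end marker. -/
def encodeName {A S : Type} (X : Name) : List (Letter A S) :=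
  X.map Letter.bit ++ [Letter.endName]

/-- A type in prefix notation. -/
def encodeTy {A S : Type} : Ty → List (Letter A S)
  | .pr => [.pr]
  | .fn σ v τ => .arrow v :: (encodeTy σ ++ encodeTy τ)

/-- A formula in prefix notation. -/
def encodeFormula {A S : Type} : Formula A → List (Letter A S)
  | .prop q => .prop :: encodeName q
  | .var X => .var :: encodeName X
  | .neg φ => .neg :: encodeFormula φ
  | .or φ ψ => .or :: (encodeFormula φ ++ encodeFormula ψ)
  | .dia a φ => .dia a :: encodeFormula φ
  | .app φ ψ => .app :: (encodeFormula φ ++ encodeFormula ψ)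
  | .lam X v σ φ => .lam v :: (encodeName X ++ encodeTy σ ++ encodeFormula φ)
  | .mu X τ φ => .mu :: (encodeName X ++ encodeTy τ ++ encodeFormula φ)

/-- The model checking problem of `HFL(k,m)` on the fixed transition system `T`: the set of all
words that consist of a state `s` and a sentence `φ` of `HFL(k,m)` with `T, s ⊨ φ`. -/
def modelChecking {A S : Type} (T : LTS A S) (k m : ℕ) : Language (Letter A S) :=
  {w | ∃ s φ, w = .state s :: encodeFormula φ ∧ φ ∈ Fragment A k m ∧ Satisfies T s φ}

/-! ### Complexity -/

open Classical in
/-- The class `EXPTIME`: some deterministic Turing machine (with finitely many stacks over finite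
alphabets) decides `L`, answering every input of length `n` within `2 ^ p n` steps, for some
polynomial `p`. -/
def InEXPTIME {Γ : Type} (L : Language Γ) : Prop :=
  ∃ (M : Turing.TM2ComputableInTime (id : List Γ → List Γ) Computability.encodeBool
      (fun w => decide (w ∈ L))) (p : Polynomial ℕ),
    (∀ i, Finite (M.tm.Γ i)) ∧ ∀ n, M.time n ≤ 2 ^ p.eval n

end HFL

/-! Since `T`, `k` and `m` are fixed, only finitely many types are available (`finite_types`), and
each denotes a finite lattice (`Den.finite`). The typed values `Val` therefore form a finite set
whose size does not depend on the formula, and binders can be evaluated by brute force: a binder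
makes one pass over its body for every candidate for its variable, and the resulting finite table
determines the function or the infimum of the pre-fixed points. The numbers of passes multiply only
along nested binders, so the total time is a constant to the power `n` times a polynomial for local
work such as looking up variables.

Typing is decided by the same recursion. A variable is bound to a variance together with a value,
and a formula evaluates to two optional values, one for the current context and one for its
complement. A value is present exactly when the typing and the semantics both succeed
(`isVal_eval`). Negations and arguments of variance `-` or `0` consult the opposite context; a
binder also learns whether its name is already bound, because contexts require fresh names.

The two concerns meet in `Algebra`. The machine `evaluator` evaluates terms over an arbitrary
algebra within the exponential bound of `reach_eval`, after a stack of expected sorts has filtered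
out malformed words (`checkWord_iff`). The finite algebra `typedAlgebra` supplies the meaning,
`inEXPTIME_of_algebra` combines the time bounds, and `StackMachine.inEXPTIME` passes from five
stacks to the official machine model. -/

namespace HFL

/-! ### Machines with five stacks -/

/-- An action on the top of a stack. -/
inductive Act (α : Type) where
  | keep | pop | push (a : α) | set (a : α)

/-- The effect of an action on a stack. -/
def Act.run {α : Type} : Act α → List α → List α
  | .keep, s => s
  | .pop, s => s.tail
  | .push a, s => a :: s
  | .set a, s => a :: s.tail

/-- A deterministic machine with an input stack and four work stacks. In every step it reads the
tops of all stacks, and either acts on each stack or halts with an answer. -/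
structure StackMachine (Q R L E K : Type) where
  start : Q
  next : Q → Option R → Option L → Option E → Option E → Option K →
    (Q × Act R × Act L × Act E × Act E × Act K) ⊕ Bool

/-- Configurations of a machine with five stacks. -/
structure Conf (Q R L E K : Type) where
  state : Q
  input : List R
  left : List L
  env : List E
  temp : List E
  control : List K

namespace StackMachine

variable {Q R L E K : Type} (M : StackMachine Q R L E K)

/-- One step of the machine. -/
def step (c : Conf Q R L E K) : Conf Q R L E K ⊕ Bool :=
  match M.next c.state c.input.head? c.left.head? c.env.head? c.temp.head? c.control.head? with
  | .inl (q, r, l, e, z, k) =>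
      .inl ⟨q, r.run c.input, l.run c.left, e.run c.env, z.run c.temp, k.run c.control⟩
  | .inr b => .inr b

/-- `Runs n c d`: the machine gets from `c` to `d` in exactly `n` steps. -/
inductive Runs : ℕ → Conf Q R L E K → Conf Q R L E K → Prop
  | refl (c) : Runs 0 c c
  | head {n c d e} : M.step c = .inl d → Runs n d e → Runs (n + 1) c e

/-- `Reach B c d`: the machine gets from `c` to `d` in at most `B` steps. -/
def Reach (B : ℕ) (c d : Conf Q R L E K) : Prop := ∃ n ≤ B, M.Runs n c d

variable {M}

theorem Runs.trans {m n : ℕ} {c d e : Conf Q R L E K} (h : M.Runs m c d) (h' : M.Runs n d e) :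
    M.Runs (m + n) c e := by
  induction h with
  | refl => simpa using h'
  | head hs _ ih => rw [Nat.add_right_comm]; exact .head hs (ih h')

theorem Reach.refl {B : ℕ} (c : Conf Q R L E K) : M.Reach B c c := ⟨0, Nat.zero_le _, .refl c⟩

theorem Reach.mono {B B' : ℕ} {c d : Conf Q R L E K} (h : M.Reach B c d) (hB : B ≤ B') :
    M.Reach B' c d := by
  obtain ⟨n, hn, h⟩ := h
  exact ⟨n, hn.trans hB, h⟩

theorem Reach.trans {B B' : ℕ} {c d e : Conf Q R L E K} (h : M.Reach B c d)
    (h' : M.Reach B' d e) : M.Reach (B + B') c e := by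
  obtain ⟨n, hn, h⟩ := h
  obtain ⟨n', hn', h'⟩ := h'
  exact ⟨n + n', by omega, h.trans h'⟩

theorem Reach.head {B : ℕ} {c d e : Conf Q R L E K} (hs : M.step c = .inl d)
    (h : M.Reach B d e) : M.Reach (B + 1) c e := by
  obtain ⟨n, hn, h⟩ := h
  exact ⟨n + 1, by omega, .head hs h⟩

/-! ### Simulation by a `TM2` machine -/

/-- The stacks of the simulating machine. -/
inductive StackId where
  | input | left | env | temp | control | output
  deriving DecidableEq

instance : Fintype StackId :=
  ⟨{.input, .left, .env, .temp, .control, .output}, fun i => by cases i <;> decide⟩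

/-- The alphabets of the simulating machine. -/
def Alphabet (R L E K : Type) : StackId → Type
  | .input => R
  | .left => L
  | .env => E
  | .temp => E
  | .control => K
  | .output => Bool

instance Alphabet.finite [Finite R] [Finite L] [Finite E] [Finite K] :
    ∀ i, Finite (Alphabet R L E K i)
  | .input => ‹Finite R›
  | .left => ‹Finite L›
  | .env => ‹Finite E›
  | .temp => ‹Finite E›
  | .control => ‹Finite K›
  | .output => inferInstanceAs (Finite Bool)

/-- The tops of all stacks. -/
abbrev Tops (R L E K : Type) : Type := ∀ i, Option (Alphabet R L E K i)

open Turing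

section
variable {Λ σ : Type}

/-- The statement that performs an action on a stack. -/
def actStmt (i : StackId) (a : Act (Alphabet R L E K i)) (q : TM2.Stmt (Alphabet R L E K) Λ σ) :
    TM2.Stmt (Alphabet R L E K) Λ σ :=
  match a with
  | .keep => q
  | .pop => .pop i (fun s _ => s) q
  | .push a => .push i (fun _ => a) q
  | .set a => .pop i (fun s _ => s) (.push i (fun _ => a) q)

theorem stepAux_actStmt (i : StackId) (a : Act (Alphabet R L E K i))
    (q : TM2.Stmt (Alphabet R L E K) Λ σ) (v : σ) (s : ∀ i, List (Alphabet R L E K i)) :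
    TM2.stepAux (actStmt i a q) v s = TM2.stepAux q v (Function.update s i (a.run (s i))) := by
  cases a <;> simp [actStmt, Act.run]

end

/-- The statement that reads the tops of all work stacks. -/
def peekStmt (q : Q) : TM2.Stmt (Alphabet R L E K) (Option (Q × Tops R L E K)) (Tops R L E K) :=
  .peek .input (fun t a => Function.update t .input a) <|
  .peek .left (fun t a => Function.update t .left a) <|
  .peek .env (fun t a => Function.update t .env a) <|
  .peek .temp (fun t a => Function.update t .temp a) <|
  .peek .control (fun t a => Function.update t .control a) <|
  .goto fun t => some (q, t)

/-- The statement for one step of the simulated machine. -/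
def stepStmt : (Q × Act R × Act L × Act E × Act E × Act K) ⊕ Bool →
    TM2.Stmt (Alphabet R L E K) (Option (Q × Tops R L E K)) (Tops R L E K)
  | .inl (q, r, l, e, z, k) =>
      actStmt .input r <| actStmt .left l <| actStmt .env e <| actStmt .temp z <|
        actStmt .control k <| peekStmt q
  | .inr b => .push .output (fun _ => b) <| .load (fun _ _ => none) .halt

variable (M) in
/-- The program of the simulating machine. -/
def program : Option (Q × Tops R L E K) →
    TM2.Stmt (Alphabet R L E K) (Option (Q × Tops R L E K)) (Tops R L E K)
  | none => peekStmt M.start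
  | some (q, t) => stepStmt (M.next q (t .input) (t .left) (t .env) (t .temp) (t .control))

/-- The stacks of a configuration. -/
def stackOf (c : Conf Q R L E K) : ∀ i, List (Alphabet R L E K i)
  | .input => c.input
  | .left => c.left
  | .env => c.env
  | .temp => c.temp
  | .control => c.control
  | .output => []

/-- The configuration of the simulating machine. -/
def toCfg (c : Conf Q R L E K) :
    TM2.Cfg (Alphabet R L E K) (Option (Q × Tops R L E K)) (Tops R L E K) :=
  ⟨some (some (c.state, fun i => (stackOf c i).head?)), fun i => (stackOf c i).head?, stackOf c⟩

/-- Peeking refreshes the entry of every stack except the output, which is never read; hence the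
assumption on `t .output`. -/
theorem stepAux_peekStmt (c : Conf Q R L E K) (t : Tops R L E K) (ht : t .output = none) :
    TM2.stepAux (peekStmt c.state) t (stackOf c) = toCfg c := by
  have h : (fun i => (stackOf c i).head?) = Function.update (Function.update (Function.update
      (Function.update (Function.update t .input (stackOf c .input).head?)
        .left (stackOf c .left).head?) .env (stackOf c .env).head?) .temp (stackOf c .temp).head?)
        .control (stackOf c .control).head? := by
    funext i
    cases i <;> simp [stackOf, ht]
  simp only [peekStmt, toCfg, TM2.stepAux, h]

/-- One simulated step costs one `TM2` step: the label already contains the tops, so the statement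
acts on the stacks and then peeks at the new tops to form the next label. -/
theorem step_toCfg {c d : Conf Q R L E K} (h : M.step c = .inl d) :
    TM2.step M.program (toCfg c) = some (toCfg d) := by
  unfold step at h
  split at h
  · rename_i q r l e z k hn
    cases h
    have hp : M.program (some (c.state, fun i => (stackOf c i).head?)) =
        stepStmt (.inl (q, r, l, e, z, k)) := congrArg stepStmt hn
    rw [toCfg, TM2.step, hp, ← stepAux_peekStmt _ (fun i => (stackOf c i).head?) rfl]
    refine congrArg some <| (stepAux_actStmt .input r _ _ _).trans <|
      (stepAux_actStmt .left l _ _ _).trans <| (stepAux_actStmt .env e _ _ _).trans <|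
      (stepAux_actStmt .temp z _ _ _).trans <| (stepAux_actStmt .control k _ _ _).trans <|
      congrArg (TM2.stepAux _ _) ?_
    funext i
    cases i <;> rfl
  · cases h

theorem step_toCfg_halt {c : Conf Q R L E K} {b : Bool} (h : M.step c = .inr b) :
    TM2.step M.program (toCfg c) =
      some ⟨none, fun _ => none, Function.update (stackOf c) .output [b]⟩ := by
  unfold step at h
  split at h
  · cases h
  · rename_i b' hn
    cases h
    have hp : M.program (some (c.state, fun i => (stackOf c i).head?)) = stepStmt (.inr b) :=
      congrArg stepStmt hn
    rw [toCfg, TM2.step, hp]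
    rfl

theorem iterate_toCfg {n : ℕ} {c d : Conf Q R L E K} (h : M.Runs n c d) :
    (flip bind (TM2.step M.program))^[n] (some (toCfg c)) = some (toCfg d) := by
  induction h with
  | refl => rfl
  | head hs _ ih =>
    rw [Function.iterate_succ_apply]
    have : flip bind (TM2.step M.program) (some (toCfg _)) = some (toCfg _) := step_toCfg hs
    rw [this, ih]

variable (M) in
/-- The simulating machine. -/
noncomputable def toFinTM2 [Finite Q] [Finite R] [Finite L] [Finite E] [Finite K] : FinTM2 where
  K := StackId
  k₀ := .input
  k₁ := .output
  Γ := Alphabet R L E K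
  Λ := Option (Q × Tops R L E K)
  main := none
  ΛFin := Fintype.ofFinite _
  σ := Tops R L E K
  initialState := fun _ => none
  σFin := Fintype.ofFinite _
  Γk₀Fin := Fintype.ofFinite _
  m := M.program

/-- A language is in `EXPTIME` if a machine with five stacks decides it in exponential time. -/
theorem inEXPTIME [Finite Q] [Finite R] [Finite L] [Finite E] [Finite K] (W : Language R)
    (p : Polynomial ℕ)
    (h : ∀ w, ∃ n q b, M.Runs n ⟨M.start, w, [], [], [], []⟩ ⟨q, [], [], [], [], []⟩ ∧
      M.step ⟨q, [], [], [], [], []⟩ = .inr b ∧ (b = true ↔ w ∈ W) ∧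
      n + 2 ≤ 2 ^ p.eval w.length) : InEXPTIME W := by
  classical
  choose n q b hr hs hb hn using h
  -- The two additional steps are the initial peek and the final halting step.
  refine ⟨⟨⟨M.toFinTM2, Equiv.refl R, Equiv.refl Bool⟩, fun n => 2 ^ p.eval n, fun w =>
    ⟨⟨n w + 2, ?_⟩, ?_⟩⟩, p, ?_, fun _ => le_rfl⟩
  · have hi : initList M.toFinTM2 (w.map (Equiv.refl R).invFun) =
        ⟨some none, fun _ => none, stackOf (⟨M.start, w, [], [], [], []⟩ : Conf Q R L E K)⟩ := by
      unfold initList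
      congr 1
      funext i
      cases i
      · exact List.map_id w
      all_goals rfl
    have hh : haltList M.toFinTM2 ((Computability.encodeBool (decide (w ∈ W))).map
        (Equiv.refl Bool).invFun) = ⟨none, fun _ => none,
          Function.update (stackOf (⟨q w, [], [], [], [], []⟩ : Conf Q R L E K)) .output [b w]⟩ := by
      have : decide (w ∈ W) = b w := by rw [Bool.eq_iff_iff]; simp [hb]
      unfold haltList
      rw [this]
      congr 1
      funext i
      cases i <;> rfl
    have h0 : TM2.step M.program ⟨some none, fun _ => none,
        stackOf (⟨M.start, w, [], [], [], []⟩ : Conf Q R L E K)⟩ =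
          some (toCfg ⟨M.start, w, [], [], [], []⟩) :=
      congrArg some (stepAux_peekStmt ⟨M.start, w, [], [], [], []⟩ (fun _ => none) rfl)
    simp only [id]
    rw [hi, Option.map_some, hh, Function.iterate_succ_apply', Function.iterate_succ_apply]
    have h1 : (flip bind M.toFinTM2.step)^[n w] (flip bind M.toFinTM2.step (some ⟨some none,
        fun _ => none, stackOf (⟨M.start, w, [], [], [], []⟩ : Conf Q R L E K)⟩)) =
          some (toCfg ⟨q w, [], [], [], [], []⟩) :=
      (congrArg (flip bind M.toFinTM2.step)^[n w] h0).trans (iterate_toCfg (hr w))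
    exact (congrArg (flip bind M.toFinTM2.step) h1).trans (step_toCfg_halt (hs w))
  · exact hn w
  · exact Alphabet.finite

end StackMachine
/-! ### Terms over a finite algebra -/

/-- Unary operators of terms. -/
inductive UnOp (A : Type) where
  | neg | dia (a : A)

/-- Binary operators of terms. -/
inductive BinOp where
  | or | app | arrow (v : Variance)

/-- Variable binders of terms. -/
inductive BindOp where
  | lam (v : Variance) | mu

/-- Terms: a common format for types and formulas. A binder has a type and a body. -/
inductive Term (A : Type) where
  | pr
  | prop (X : Name)
  | var (X : Name)
  | un (o : UnOp A) (t : Term A)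
  | bin (o : BinOp) (t u : Term A)
  | bind (o : BindOp) (X : Name) (t u : Term A)

section
variable {A S : Type}

/-- The letter of a unary operator. -/
def UnOp.letter : UnOp A → Letter A S
  | .neg => .neg
  | .dia a => .dia a

/-- The letter of a binary operator. -/
def BinOp.letter : BinOp → Letter A S
  | .or => .or
  | .app => .app
  | .arrow v => .arrow v

/-- The letter of a binder. -/
def BindOp.letter : BindOp → Letter A S
  | .lam v => .lam v
  | .mu => .mu

/-- A term in prefix notation. -/
def Term.encode : Term A → List (Letter A S)
  | .pr => [.pr]
  | .prop X => .prop :: encodeName X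
  | .var X => .var :: encodeName X
  | .un o t => o.letter :: t.encode
  | .bin o t u => o.letter :: (t.encode ++ u.encode)
  | .bind o X t u => o.letter :: (encodeName X ++ t.encode ++ u.encode)

/-- A type as a term. -/
def Ty.toTerm : Ty → Term A
  | .pr => .pr
  | .fn σ v τ => .bin (.arrow v) σ.toTerm τ.toTerm

/-- A formula as a term. -/
def Formula.toTerm : Formula A → Term A
  | .prop q => .prop q
  | .var X => .var X
  | .neg φ => .un .neg φ.toTerm
  | .or φ ψ => .bin .or φ.toTerm ψ.toTerm
  | .dia a φ => .un (.dia a) φ.toTerm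
  | .app φ ψ => .bin .app φ.toTerm ψ.toTerm
  | .lam X v σ φ => .bind (.lam v) X σ.toTerm φ.toTerm
  | .mu X τ φ => .bind .mu X τ.toTerm φ.toTerm

theorem Ty.encode_toTerm (τ : Ty) : (τ.toTerm : Term A).encode = (encodeTy τ : List (Letter A S)) := by
  induction τ with
  | pr => rfl
  | fn σ v τ ih₁ ih₂ => simp [Ty.toTerm, Term.encode, encodeTy, BinOp.letter, ih₁, ih₂]

theorem Formula.encode_toTerm (φ : Formula A) :
    φ.toTerm.encode = (encodeFormula φ : List (Letter A S)) := by
  induction φ <;>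
    simp [Formula.toTerm, Term.encode, encodeFormula, BinOp.letter, UnOp.letter, BindOp.letter,
      Ty.encode_toTerm, *]

end

/-- The operations of an algebra `V` in which terms are evaluated. The value of a proposition is
computed by an automaton, and the variables range over a set with `N + 1` elements. A binder maps
the old value of the bound variable, the value of the type, and the family of the values of the
body to a value. -/
structure Algebra (A S V Q : Type) (N : ℕ) where
  pr : V
  un : UnOp A → V → V
  bin : BinOp → V → V → V
  init : Q
  read : Q → Bool → Q
  prop : Q → V
  var : Option (Fin (N + 1)) → V
  bind : BindOp → Option (Fin (N + 1)) → V → (Fin (N + 1) → V) → V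
  accept : S → V → Bool

/-- The value of a variable in an environment. -/
def lookup {D : Type} (X : Name) : List (Name × D) → Option D
  | [] => none
  | (Y, e) :: ρ => if Y = X then some e else lookup X ρ

/-- The value of a term in an environment. -/
def Term.eval {A S V Q : Type} {N : ℕ} (I : Algebra A S V Q N) :
    Term A → List (Name × Fin (N + 1)) → V
  | .pr, _ => I.pr
  | .prop X, _ => I.prop (X.foldl I.read I.init)
  | .var X, ρ => I.var (lookup X ρ)
  | .un o t, ρ => I.un o (t.eval I ρ)
  | .bin o t u, ρ => I.bin o (t.eval I ρ) (u.eval I ρ)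
  | .bind o X t u, ρ =>
      I.bind o (lookup X ρ) (t.eval I ((X, 0) :: ρ)) fun e => u.eval I ((X, e) :: ρ)

/-! ### The evaluating machine -/

/-- What to do after reading a name. -/
inductive NameMode (N : ℕ) where
  | prop
  | name (m : Option BindOp) (r : Option (Fin (N + 1)))
  | bound (o : BindOp) (r : Option (Fin (N + 1)))

/-- The states of the evaluating machine. -/
inductive State (A V Q : Type) (N : ℕ) where
  | init
  | init'
  | check (name : Bool)
  | rewindAll
  | eval
  | ret (v : V)
  | lookup (m : Option BindOp)
  | compare (m : Option BindOp) (e : Fin (N + 1))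
  | back (m : Option BindOp) (r : Option (Fin (N + 1)))
  | skip (m : Option BindOp)
  | restore (m : Option BindOp) (r : Option (Fin (N + 1)))
  | forward (q : Q) (m : NameMode N)
  | pushName (o : BindOp) (r : Option (Fin (N + 1)))
  | start (i : Fin (N + 1))
  | rewind (i : Fin (N + 1))
  | popName (v : V)
  | clean (b : Bool)

/-- The symbols of the control stack. -/
inductive Frame (A S V : Type) (N : ℕ) where
  | sort (formula : Bool)
  | top (s : S)
  | un (o : UnOp A)
  | binLeft (o : BinOp)
  | binRight (o : BinOp) (v : V)
  | bindTy (o : BindOp) (r : Option (Fin (N + 1)))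
  | loop (o : BindOp) (r : Option (Fin (N + 1))) (a : V) (i : Fin (N + 1)) (f : Fin (N + 1) → V)

/-- The symbols of the environment stack. -/
inductive EnvSym (N : ℕ) where
  | entry (e : Fin (N + 1))
  | bit (b : Bool)

section
variable {A S V Q : Type} {N : ℕ}

/-! ### Finiteness of the states and alphabets -/

instance : Finite Variance := .of_equiv _ (proxy_equiv% Variance)

instance : Finite BinOp := .of_equiv _ (proxy_equiv% BinOp)

instance : Finite BindOp := .of_equiv _ (proxy_equiv% BindOp)

instance [Finite A] : Finite (UnOp A) := .of_equiv _ (proxy_equiv% (UnOp A))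

instance [Finite A] [Finite S] : Finite (Letter A S) := .of_equiv _ (proxy_equiv% (Letter A S))

instance : Finite (NameMode N) := .of_equiv _ (proxy_equiv% (NameMode N))

instance : Finite (EnvSym N) := .of_equiv _ (proxy_equiv% (EnvSym N))

instance [Finite V] [Finite Q] : Finite (State A V Q N) :=
  .of_equiv _ (proxy_equiv% (State A V Q N))

set_option synthInstance.maxSize 512 in
set_option synthInstance.maxHeartbeats 200000 in
instance [Finite A] [Finite S] [Finite V] : Finite (Frame A S V N) :=
  .of_equiv _ (proxy_equiv% (Frame A S V N))

/-- The predecessor of a number, if there is one. -/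
def previous : Fin (N + 1) → Option (Fin (N + 1)) :=
  Fin.cases none fun i => some i.castSucc

/-- Checking the syntax: the transition on a letter, given whether a name is being read and which
sort is expected. -/
def checkNext : Bool → Option Bool → Letter A S → Option (Bool × Act Bool)
  | true, _, .bit _ => some (true, .keep)
  | true, _, .endName => some (false, .keep)
  | false, some true, .prop => some (true, .pop)
  | false, some true, .var => some (true, .pop)
  | false, some true, .neg => some (false, .keep)
  | false, some true, .dia _ => some (false, .keep)
  | false, some true, .or => some (false, .push true)
  | false, some true, .app => some (false, .push true)
  | false, some true, .lam _ => some (true, .push false)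
  | false, some true, .mu => some (true, .push false)
  | false, some false, .pr => some (false, .pop)
  | false, some false, .arrow _ => some (false, .push false)
  | _, _, _ => none

/-- The sort in a frame. -/
def Frame.sort? : Frame A S V N → Option Bool
  | .sort b => some b
  | _ => none

/-- The image of an action. -/
def Act.map {α β : Type} (f : α → β) : Act α → Act β
  | .keep => .keep
  | .pop => .pop
  | .push a => .push (f a)
  | .set a => .set (f a)

/-- The actions of the evaluating machine. -/
abbrev Move (A S V Q : Type) (N : ℕ) : Type :=
  (State A V Q N × Act (Letter A S) × Act (Option (Letter A S)) × Act (EnvSym N) ×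
    Act (EnvSym N) × Act (Frame A S V N)) ⊕ Bool

/-- Giving a negative answer. -/
def reject : Move A S V Q N := .inl (.clean false, .keep, .keep, .keep, .keep, .keep)

/-- Reading a letter. -/
def pass (q : State A V Q N) (c : Letter A S) (k : Act (Frame A S V N)) : Move A S V Q N :=
  .inl (q, .pop, .push (some c), .keep, .keep, k)

variable (I : Algebra A S V Q N)

/-- The start of the evaluation of a term. -/
def evalNext : Letter A S → Move A S V Q N
  | .pr => pass (.ret I.pr) .pr .keep
  | .neg => pass .eval .neg (.push (.un .neg))
  | .dia a => pass .eval (.dia a) (.push (.un (.dia a)))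
  | .or => pass .eval .or (.push (.binLeft .or))
  | .app => pass .eval .app (.push (.binLeft .app))
  | .arrow v => pass .eval (.arrow v) (.push (.binLeft (.arrow v)))
  | .prop => pass (.forward I.init .prop) .prop .keep
  | .var => pass (.lookup none) .var .keep
  | .lam v => pass (.lookup (some (.lam v))) (.lam v) .keep
  | .mu => pass (.lookup (some .mu)) .mu .keep
  | _ => reject

/-- The end of the evaluation of a term. -/
def retNext (v : V) : Frame A S V N → Move A S V Q N
  | .un o => .inl (.ret (I.un o v), .keep, .keep, .keep, .keep, .pop)
  | .binLeft o => .inl (.eval, .keep, .keep, .keep, .keep, .set (.binRight o v))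
  | .binRight o u => .inl (.ret (I.bin o u v), .keep, .keep, .keep, .keep, .pop)
  | .bindTy o r =>
      -- The marker `none` on the left stack shows where the body begins, so that it can be rewound.
      -- The initial table is arbitrary, as all its entries get overwritten.
      .inl (.start (Fin.last N), .keep, .push none, .keep, .keep,
        .set (.loop o r v (Fin.last N) fun _ => v))
  | .loop o r a i f =>
      match previous i with
      | none => .inl (.popName (I.bind o r a (Function.update f i v)),
          .keep, .keep, .pop, .keep, .pop)
      | some j => .inl (.rewind j, .keep, .keep, .keep, .keep,
          .set (.loop o r a j (Function.update f i v)))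
  | .top s => .inl (.clean (I.accept s v), .keep, .keep, .keep, .keep, .pop)
  | .sort _ => reject

/-- The end of a name. -/
def endNext (q : Q) : NameMode N → Move A S V Q N
  | .prop => pass (.ret (I.prop q)) .endName .keep
  | .name none r => pass (.ret (I.var r)) .endName .keep
  | .name (some o) r => .inl (.pushName o r, .keep, .keep, .keep, .keep, .keep)
  | .bound o r => .inl (.eval, .pop, .push (some .endName), .push (.entry 0), .keep,
      .push (.bindTy o r))

/-- The machine that evaluates terms. -/
def evaluator : StackMachine (State A V Q N) (Letter A S) (Option (Letter A S)) (EnvSym N)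
    (Frame A S V N) where
  start := .init
  next q r l e z k :=
    match q with
    | .init =>
        match r with
        | some (.state s) => .inl (.init', .pop, .keep, .keep, .keep, .push (.top s))
        | _ => reject
    | .init' => .inl (.check false, .keep, .keep, .keep, .keep, .push (.sort true))
    | .check b =>
        match r with
        | some c =>
            match checkNext b (k.bind Frame.sort?) c with
            | some (b', a) => pass (.check b') c (a.map .sort)
            | none => reject
        | none =>
            match b, k with
            | false, some (.top _) => .inl (.rewindAll, .keep, .keep, .keep, .keep, .keep)
            | _, _ => reject
    | .rewindAll =>
        match l with
        | some (some c) => .inl (.rewindAll, .push c, .pop, .keep, .keep, .keep)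
        | _ => .inl (.eval, .keep, .keep, .keep, .keep, .keep)
    | .eval =>
        match r with
        | some c => evalNext I c
        | none => reject
    | .ret v =>
        match k with
        | some f => retNext I v f
        | none => reject
    | .lookup m =>
        match e with
        -- Inspected environment symbols move to the temporary stack, from which `restore` brings
        -- them back.
        | some (.entry i) => .inl (.compare m i, .keep, .keep, .pop, .push (.entry i), .keep)
        | _ => .inl (.restore m none, .keep, .keep, .keep, .keep, .keep)
    | .compare m i =>
        match r, e with
        | some (.bit a), some (.bit b) =>
            if a = b then
              .inl (.compare m i, .pop, .push (some (.bit a)), .pop, .push (.bit b), .keep)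
            else .inl (.back m none, .keep, .keep, .keep, .keep, .keep)
        | some (.bit _), _ => .inl (.back m none, .keep, .keep, .keep, .keep, .keep)
        | _, some (.bit _) => .inl (.back m none, .keep, .keep, .keep, .keep, .keep)
        | _, _ => .inl (.back m (some i), .keep, .keep, .keep, .keep, .keep)
    | .back m i =>
        match l with
        | some (some (.bit b)) => .inl (.back m i, .push (.bit b), .pop, .keep, .keep, .keep)
        | _ =>
            match i with
            | none => .inl (.skip m, .keep, .keep, .keep, .keep, .keep)
            | some i => .inl (.restore m (some i), .keep, .keep, .keep, .keep, .keep)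
    | .skip m =>
        match e with
        | some (.bit b) => .inl (.skip m, .keep, .keep, .pop, .push (.bit b), .keep)
        | _ => .inl (.lookup m, .keep, .keep, .keep, .keep, .keep)
    | .restore m i =>
        match z with
        | some x => .inl (.restore m i, .keep, .keep, .push x, .pop, .keep)
        | none => .inl (.forward I.init (.name m i), .keep, .keep, .keep, .keep, .keep)
    | .forward q m =>
        match r with
        | some (.bit b) => pass (.forward (I.read q b) m) (.bit b) .keep
        | _ => endNext I q m
    | .pushName o i =>
        match l with
        | some (some (.bit b)) =>
            .inl (.pushName o i, .push (.bit b), .pop, .push (.bit b), .keep, .keep)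
        | _ => .inl (.forward I.init (.bound o i), .keep, .keep, .keep, .keep, .keep)
    | .start i =>
        -- Index `0` is the last pass: no further rewinding is needed, so the marker is removed
        -- before the body is read.
        .inl (.eval, .keep, match previous i with | none => .pop | some _ => .keep,
          .set (.entry i), .keep, .keep)
    | .rewind i =>
        match l with
        | some (some c) => .inl (.rewind i, .push c, .pop, .keep, .keep, .keep)
        | _ => .inl (.start i, .keep, .keep, .keep, .keep, .keep)
    | .popName v =>
        match e with
        | some (.bit _) => .inl (.popName v, .keep, .keep, .pop, .keep, .keep)
        | _ => .inl (.ret v, .keep, .keep, .keep, .keep, .keep)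
    -- The machine model requires all work stacks to be empty on halting.
    | .clean b =>
        match r, l, e, z, k with
        | none, none, none, none, none => .inr b
        | _, _, _, _, _ => .inl (.clean b, .pop, .pop, .pop, .pop, .pop)

end

/-! ### Runs of the evaluating machine -/

section
variable {A S V Q : Type} {N : ℕ} {I : Algebra A S V Q N}
variable {R : List (Letter A S)} {L : List (Option (Letter A S))} {E Z : List (EnvSym N)}
  {K : List (Frame A S V N)}

open StackMachine

/-- A word that has been read, as a part of the left stack. -/
def passed (w : List (Letter A S)) : List (Option (Letter A S)) := (w.map some).reverse

/-- The bits of a name. -/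
def bits (X : Name) : List (Letter A S) := X.map .bit

/-- An environment on the stack. -/
def encodeEnv : List (Name × Fin (N + 1)) → List (EnvSym N)
  | [] => []
  | (X, e) :: ρ => .entry e :: (X.map .bit ++ encodeEnv ρ)

theorem passed_cons (c : Letter A S) (w) : passed (c :: w) ++ L = passed w ++ some c :: L := by
  simp [passed]

theorem passed_append (w w' : List (Letter A S)) : passed (w ++ w') = passed w' ++ passed w := by
  simp [passed]

theorem reach_forward (X : Name) (q : Q) (m : NameMode N) :
    (evaluator I).Reach X.length ⟨.forward q m, bits X ++ R, L, E, Z, K⟩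
      ⟨.forward (X.foldl I.read q) m, R, passed (bits X) ++ L, E, Z, K⟩ := by
  induction X generalizing q L with
  | nil => exact .refl _
  | cons b X ih =>
    refine .head (d := ⟨.forward (I.read q b) m, bits X ++ R, some (.bit b) :: L, E, Z, K⟩) rfl ?_
    have h := ih (L := some (.bit b) :: L) (I.read q b)
    rw [← passed_cons] at h
    exact h

/-- The hypothesis on `L` marks the beginning of the name: in use, the letter that introduces the
name lies below its bits. -/
theorem reach_back (X : Name) (m i) (hL : ∀ b, L.head? ≠ some (some (.bit b))) :
    (evaluator I).Reach (X.length + 1) ⟨.back m i, R, passed (bits X) ++ L, E, Z, K⟩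
      ⟨match i with | none => .skip m | some i => .restore m (some i), bits X ++ R, L, E, Z, K⟩ := by
  induction X using List.reverseRecOn generalizing R with
  | nil =>
    refine .head ?_ (.refl _)
    rcases L with _ | ⟨_ | c, L⟩
    · cases i <;> rfl
    · cases i <;> rfl
    · cases c <;> first | (cases i <;> rfl) | exact absurd rfl (hL _)
  | append_singleton X b ih =>
    have h : passed (bits (X ++ [b]) : List (Letter A S)) ++ L =
        some (.bit b) :: (passed (bits X) ++ L) := by simp [passed, bits]
    rw [h, List.length_append]
    refine .head (d := ⟨.back m i, .bit b :: R, passed (bits X) ++ L, E, Z, K⟩) rfl ?_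
    have := ih (R := .bit b :: R)
    simpa [bits] using this

/-- The name is scanned from its end, so its bits arrive in the right order on both the input and
the environment stack. -/
theorem reach_pushName (X : Name) (o i) (hL : ∀ b, L.head? ≠ some (some (.bit b))) :
    (evaluator I).Reach (X.length + 1) ⟨.pushName o i, R, passed (bits X) ++ L, E, Z, K⟩
      ⟨.forward I.init (.bound o i), bits X ++ R, L, X.map .bit ++ E, Z, K⟩ := by
  induction X using List.reverseRecOn generalizing R E with
  | nil =>
    refine .head ?_ (.refl _)
    rcases L with _ | ⟨_ | c, L⟩
    · rfl
    · rfl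
    · cases c <;> first | rfl | exact absurd rfl (hL _)
  | append_singleton X b ih =>
    have h : passed (bits (X ++ [b]) : List (Letter A S)) ++ L =
        some (.bit b) :: (passed (bits X) ++ L) := by simp [passed, bits]
    rw [h, List.length_append]
    refine .head (d := ⟨.pushName o i, .bit b :: R, passed (bits X) ++ L, .bit b :: E, Z, K⟩)
      rfl ?_
    have := ih (R := .bit b :: R) (E := .bit b :: E)
    simpa [bits] using this

theorem reach_restore (m i) :
    (evaluator I).Reach (Z.length + 1) ⟨.restore m i, R, L, E, Z, K⟩
      ⟨.forward I.init (.name m i), R, L, Z.reverse ++ E, [], K⟩ := by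
  induction Z generalizing E with
  | nil => exact .head rfl (.refl _)
  | cons x Z ih =>
    refine .head (d := ⟨.restore m i, R, L, x :: E, Z, K⟩) rfl ?_
    simpa using ih (E := x :: E)

theorem reach_skip (X : Name) (m) (ρ : List (Name × Fin (N + 1))) :
    (evaluator I).Reach (X.length + 1) ⟨.skip m, R, L, X.map .bit ++ encodeEnv ρ, Z, K⟩
      ⟨.lookup m, R, L, encodeEnv ρ, (X.map .bit).reverse ++ Z, K⟩ := by
  induction X generalizing Z with
  | nil => rcases ρ with _ | ⟨⟨_, _⟩, _⟩ <;> exact .head rfl (.refl _)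
  | cons b X ih =>
    refine .head (d := ⟨.skip m, R, L, X.map .bit ++ encodeEnv ρ, .bit b :: Z, K⟩) rfl ?_
    simpa using ih (Z := .bit b :: Z)

theorem reach_popName (X : Name) (v : V) (ρ : List (Name × Fin (N + 1))) :
    (evaluator I).Reach (X.length + 1) ⟨.popName v, R, L, X.map .bit ++ encodeEnv ρ, Z, K⟩
      ⟨.ret v, R, L, encodeEnv ρ, Z, K⟩ := by
  induction X with
  | nil => rcases ρ with _ | ⟨⟨_, _⟩, _⟩ <;> exact .head rfl (.refl _)
  | cons b X ih => exact .head rfl ih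

theorem reach_rewind (w : List (Letter A S)) (i) :
    (evaluator I).Reach (w.length + 1) ⟨.rewind i, R, passed w ++ none :: L, E, Z, K⟩
      ⟨.start i, w ++ R, none :: L, E, Z, K⟩ := by
  induction w using List.reverseRecOn generalizing R with
  | nil => exact .head rfl (.refl _)
  | append_singleton w c ih =>
    have h : passed (w ++ [c]) ++ none :: L = some c :: (passed w ++ none :: L) := by
      simp [passed]
    rw [h, List.length_append]
    refine .head (d := ⟨.rewind i, c :: R, passed w ++ none :: L, E, Z, K⟩) rfl ?_
    simpa using ih (R := c :: R)

theorem reach_rewindAll (w : List (Letter A S)) :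
    (evaluator I).Reach (w.length + 1) ⟨.rewindAll, R, passed w, E, Z, K⟩
      ⟨.eval, w ++ R, [], E, Z, K⟩ := by
  induction w using List.reverseRecOn generalizing R with
  | nil => exact .head rfl (.refl _)
  | append_singleton w c ih =>
    have h : passed (w ++ [c]) = some c :: passed w := by simp [passed]
    rw [h, List.length_append]
    refine .head (d := ⟨.rewindAll, c :: R, passed w, E, Z, K⟩) rfl ?_
    simpa using ih (R := c :: R)

theorem reach_clean (b : Bool) (n : ℕ) (hR : R.length ≤ n) (hL : L.length ≤ n)
    (hE : E.length ≤ n) (hZ : Z.length ≤ n) (hK : K.length ≤ n) :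
    (evaluator I).Reach n ⟨.clean b, R, L, E, Z, K⟩ ⟨.clean b, [], [], [], [], []⟩ := by
  induction n generalizing R L E Z K with
  | zero =>
    simp only [Nat.le_zero, List.length_eq_zero_iff] at hR hL hE hZ hK
    subst hR hL hE hZ hK
    exact .refl _
  | succ n ih =>
    by_cases h : R = [] ∧ L = [] ∧ E = [] ∧ Z = [] ∧ K = []
    · obtain ⟨rfl, rfl, rfl, rfl, rfl⟩ := h
      exact .refl _
    · refine .head (d := ⟨.clean b, R.tail, L.tail, E.tail, Z.tail, K.tail⟩) ?_
        (ih ?_ ?_ ?_ ?_ ?_)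
      · cases R <;> cases L <;> cases E <;> cases Z <;> cases K <;>
          first | rfl | exact absurd ⟨rfl, rfl, rfl, rfl, rfl⟩ h
      all_goals rw [List.length_tail]; omega

end
-- Environment lookup and evaluation of terms
section
variable {A S V Q : Type} {N : ℕ} {I : Algebra A S V Q N}
variable {R : List (Letter A S)} {L : List (Option (Letter A S))} {E Z : List (EnvSym N)}
  {K : List (Frame A S V N)}

open StackMachine

/-- The comparison runs in lockstep and may stop anywhere. The splittings record where: the parts
`Y₁` and `X₁` already read lie on the left and the temporary stack. -/
theorem reach_compare (m e) (X Y : Name) (ρ : List (Name × Fin (N + 1))) :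
    ∃ Y₁ Y₂ X₁ X₂, Y = Y₁ ++ Y₂ ∧ X = X₁ ++ X₂ ∧ (evaluator I).Reach (Y.length + 1)
      ⟨.compare m e, bits Y ++ .endName :: R, L, X.map .bit ++ encodeEnv ρ, Z, K⟩
      ⟨.back m (if X = Y then some e else none), bits Y₂ ++ .endName :: R, passed (bits Y₁) ++ L,
        X₂.map .bit ++ encodeEnv ρ, (X₁.map .bit).reverse ++ Z, K⟩ := by
  induction Y generalizing X L Z with
  | nil =>
    refine ⟨[], [], [], X, rfl, rfl, .head ?_ (.refl _)⟩
    cases X with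
    | nil => rcases ρ with _ | ⟨⟨_, _⟩, _⟩ <;> rfl
    | cons b X => rfl
  | cons a Y ih =>
    cases X with
    | nil =>
      refine ⟨[], a :: Y, [], [], rfl, rfl, .head ?_ (.refl _)⟩
      rcases ρ with _ | ⟨⟨_, _⟩, _⟩ <;> rfl
    | cons b X =>
      by_cases hab : a = b
      · subst hab
        obtain ⟨Y₁, Y₂, X₁, X₂, rfl, rfl, h⟩ := ih X (L := some (.bit a) :: L) (Z := .bit a :: Z)
        refine ⟨a :: Y₁, Y₂, a :: X₁, X₂, rfl, rfl, .head
          (d := ⟨.compare m e, bits (Y₁ ++ Y₂) ++ .endName :: R, some (.bit a) :: L,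
            (X₁ ++ X₂).map .bit ++ encodeEnv ρ, .bit a :: Z, K⟩) ?_ ?_⟩
        · simp [StackMachine.step, evaluator, bits, Act.run]
        · simpa [bits, passed] using h
      · refine ⟨[], a :: Y, [], b :: X, rfl, rfl, .head ?_ (.refl _)⟩
        have : b :: X ≠ a :: Y := fun h => hab (List.cons.inj h).1.symm
        simp [StackMachine.step, evaluator, bits, Act.run, hab, this, passed]

/-- No symbol is ever discarded: the reversed temporary stack followed by the rest of the
environment stays the same word. This invariant lets `reach_restore` rebuild the environment
wherever the search stops. -/
theorem reach_lookup (m) (Y : Name) (ρ : List (Name × Fin (N + 1)))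
    (hL : ∀ b, L.head? ≠ some (some (.bit b))) :
    ∃ E' Z', Z'.reverse ++ E' = Z.reverse ++ encodeEnv ρ ∧
      (evaluator I).Reach ((encodeEnv ρ).length * (2 * Y.length + 4) + 1)
        ⟨.lookup m, bits Y ++ .endName :: R, L, encodeEnv ρ, Z, K⟩
        ⟨.restore m (lookup Y ρ), bits Y ++ .endName :: R, L, E', Z', K⟩ := by
  induction ρ generalizing Z with
  | nil => exact ⟨[], Z, rfl, .head rfl (.refl _)⟩
  | cons p ρ ih =>
    obtain ⟨X, e⟩ := p
    obtain ⟨Y₁, Y₂, X₁, X₂, hY, hX, h⟩ := reach_compare (I := I) (R := R) (L := L) (K := K)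
      (Z := .entry e :: Z) m e X Y ρ
    have hb := reach_back (I := I) (R := bits Y₂ ++ .endName :: R) (L := L) (K := K)
      (E := X₂.map .bit ++ encodeEnv ρ) (Z := (X₁.map .bit).reverse ++ .entry e :: Z) Y₁ m
      (if X = Y then some e else none) hL
    have hh := (Reach.head (d := ⟨.compare m e, bits Y ++ .endName :: R, L,
      X.map .bit ++ encodeEnv ρ, .entry e :: Z, K⟩) rfl (h.trans hb) :
        (evaluator I).Reach _ ⟨.lookup m, bits Y ++ .endName :: R, L, encodeEnv ((X, e) :: ρ), Z, K⟩ _)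
    have hY' : (bits Y₁ ++ (bits Y₂ ++ .endName :: R) : List (Letter A S)) =
        bits Y ++ .endName :: R := by simp [hY, bits]
    rw [hY'] at hh
    have h1 : Y₁.length ≤ Y.length := by simp [hY]
    have h2 : X₂.length ≤ X.length := by simp [hX]
    have hlen : (encodeEnv ((X, e) :: ρ)).length = X.length + 1 + (encodeEnv ρ).length := by
      simp [encodeEnv]; omega
    -- Charging `2 * Y.length + 4` to every symbol of the entry also pays for skipping the rest of
    -- its name.
    have hc : 2 * Y.length + 4 + X.length ≤ (X.length + 1) * (2 * Y.length + 4) := by nlinarith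
    by_cases hXY : X = Y
    · rw [if_pos hXY] at hh
      rw [show lookup Y ((X, e) :: ρ) = some e from if_pos hXY]
      refine ⟨_, _, ?_, hh.mono ?_⟩
      · simp [encodeEnv, hX]
      · rw [hlen, add_mul]; omega
    · rw [if_neg hXY] at hh
      obtain ⟨E', Z', hEZ, hr⟩ := ih (Z := (X₂.map .bit).reverse ++
        ((X₁.map .bit).reverse ++ .entry e :: Z))
      rw [show lookup Y ((X, e) :: ρ) = lookup Y ρ from if_neg hXY]
      refine ⟨E', Z', ?_, ((hh.trans (reach_skip X₂ m ρ)).trans hr).mono ?_⟩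
      · simp [hEZ, encodeEnv, hX]
      · rw [hlen, add_mul]; omega

/-- Looking a name up and reading it. -/
theorem reach_lookup_forward (m) (Y : Name) (ρ : List (Name × Fin (N + 1)))
    (hL : ∀ b, L.head? ≠ some (some (.bit b))) :
    ∃ q, (evaluator I).Reach ((encodeEnv ρ).length * (2 * Y.length + 5) + Y.length + 2)
      ⟨.lookup m, bits Y ++ .endName :: R, L, encodeEnv ρ, [], K⟩
      ⟨.forward q (.name m (lookup Y ρ)), .endName :: R, passed (bits Y) ++ L,
        encodeEnv ρ, [], K⟩ := by
  obtain ⟨E', Z', h, hr⟩ := reach_lookup (I := I) (R := R) (K := K) (Z := []) m Y ρ hL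
  have hr' := (hr.trans (reach_restore m _)).trans ((reach_forward Y _ _))
  rw [h] at hr'
  refine ⟨_, hr'.mono ?_⟩
  · have : Z'.length ≤ (encodeEnv ρ).length := by
      have := congrArg List.length h
      simp at this
      omega
    nlinarith

/-- A bound for the time that is spent at one node of a term, where `M` bounds the size of the
environment and of the term. -/
def overhead (M : ℕ) : ℕ := 2 * (M + 5) ^ 2

/-- The machine counts down from `i` to `0`. The table `f` needs to be correct only above `i`, and
the old entry `e` is irrelevant because each pass begins by overwriting it. -/
theorem reach_loop {ρ : List (Name × Fin (N + 1))} {X : Name} {u : Term A} {B : ℕ}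
    (hu : ∀ (e : Fin (N + 1)) (R : List (Letter A S)) L K, (evaluator I).Reach B
      ⟨.eval, u.encode ++ R, L, encodeEnv ((X, e) :: ρ), [], K⟩
      ⟨.ret (u.eval I ((X, e) :: ρ)), R, passed u.encode ++ L, encodeEnv ((X, e) :: ρ), [], K⟩)
    (o r a) (i : Fin (N + 1)) (f : Fin (N + 1) → V)
    (hf : ∀ j, i < j → f j = u.eval I ((X, j) :: ρ)) (e : Fin (N + 1)) :
    (evaluator I).Reach ((i + 1) * (B + (u.encode (S := S)).length + 3))
      ⟨.start i, u.encode ++ R, none :: L, encodeEnv ((X, e) :: ρ), [], .loop o r a i f :: K⟩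
      ⟨.popName (I.bind o r a fun j => u.eval I ((X, j) :: ρ)), R, passed u.encode ++ L,
        X.map .bit ++ encodeEnv ρ, [], K⟩ := by
  induction i using Fin.induction generalizing f e with
  | zero =>
    have hs : (evaluator I).step
        ⟨.start 0, u.encode ++ R, none :: L, encodeEnv ((X, e) :: ρ), [], .loop o r a 0 f :: K⟩ =
        .inl ⟨.eval, u.encode ++ R, L, encodeEnv ((X, 0) :: ρ), [], .loop o r a 0 f :: K⟩ := rfl
    refine ((Reach.head hs ((hu _ R L _).trans (.head (B := 0) ?_ (.refl _))))).mono (by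
      simp; omega)
    -- Updating the entry at `0` completes the table.
    have : (fun j => u.eval I ((X, j) :: ρ)) =
        Function.update f 0 (u.eval I ((X, 0) :: ρ)) := by
      funext j
      by_cases hj : j = 0
      · subst hj; simp
      · rw [Function.update_of_ne hj, hf j (Fin.pos_of_ne_zero hj)]
    rw [this]
    rfl
  | succ i ih =>
    have hs : (evaluator I).step ⟨.start i.succ, u.encode ++ R, none :: L, encodeEnv ((X, e) :: ρ),
          [], .loop o r a i.succ f :: K⟩ =
        .inl ⟨.eval, u.encode ++ R, none :: L, encodeEnv ((X, i.succ) :: ρ), [],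
          .loop o r a i.succ f :: K⟩ := rfl
    have hs' : (evaluator I).step ⟨.ret (u.eval I ((X, i.succ) :: ρ)), R,
          passed u.encode ++ none :: L, encodeEnv ((X, i.succ) :: ρ), [],
          .loop o r a i.succ f :: K⟩ =
        .inl ⟨.rewind i.castSucc, R, passed u.encode ++ none :: L, encodeEnv ((X, i.succ) :: ρ), [],
          .loop o r a i.castSucc (Function.update f i.succ (u.eval I ((X, i.succ) :: ρ))) :: K⟩ :=
      rfl
    refine (Reach.head hs ((hu _ R (none :: L) _).trans (.head hs'
      ((reach_rewind _ _).trans (ih _ (fun j hj => ?_) _))))).mono ?_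
    · by_cases hj' : j = i.succ
      · subst hj'; simp
      · rw [Function.update_of_ne hj']
        refine hf j (lt_of_le_of_ne ?_ (Ne.symm hj'))
        exact Fin.castSucc_lt_iff_succ_le.mp hj
    · simp only [Fin.val_succ, Fin.val_castSucc]
      ring_nf
      omega

/-- The machine evaluates terms. -/
theorem reach_eval (t : Term A) (ρ : List (Name × Fin (N + 1))) (M : ℕ)
    (hM : (encodeEnv ρ).length + (t.encode (S := S)).length ≤ M) (R : List (Letter A S)) (L K) :
    (evaluator I).Reach (overhead M * (2 * N + 5) ^ (t.encode (S := S)).length)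
      ⟨.eval, t.encode ++ R, L, encodeEnv ρ, [], K⟩
      ⟨.ret (t.eval I ρ), R, passed t.encode ++ L, encodeEnv ρ, [], K⟩ := by
  have hp : ∀ n, 1 ≤ (2 * N + 5) ^ n := fun n => Nat.one_le_pow _ _ (by omega)
  -- `M` stays fixed: a binder adds its name and one symbol to the environment, but the subterm is
  -- shorter by at least as much, so the sum in `hM` never grows.
  induction t generalizing ρ R L K with
  | pr =>
    refine (Reach.head (B := 0) rfl (.refl _)).mono ?_
    have := hp (Term.pr.encode : List (Letter A S)).length
    unfold overhead
    nlinarith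
  | prop X =>
    simp only [Term.encode, encodeName, List.cons_append, List.append_assoc, List.length_cons,
      List.length_append, List.length_map] at hM ⊢
    refine (Reach.head (d := ⟨.forward I.init .prop, bits X ++ .endName :: R, some .prop :: L,
      encodeEnv ρ, [], K⟩) rfl ((reach_forward X _ _).trans (.head (B := 0)
      (d := ⟨.ret _, R, some .endName :: (passed (bits X) ++ some .prop :: L),
      encodeEnv ρ, [], K⟩) rfl ?_))).mono (B := X.length + 1 + 1) ?_
    · simp [passed, bits, Term.eval]
      exact .refl _
    · refine le_trans ?_ (Nat.le_mul_of_pos_right _ (hp _))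
      unfold overhead
      nlinarith
  | var X =>
    simp only [Term.encode, encodeName, List.cons_append, List.append_assoc, List.length_cons,
      List.length_append, List.length_map] at hM ⊢
    obtain ⟨q, h⟩ := reach_lookup_forward (I := I) (R := R) (L := some .var :: L) (K := K) none X ρ
      (by simp)
    refine (Reach.head (d := ⟨.lookup none, bits X ++ .endName :: R, some .var :: L,
      encodeEnv ρ, [], K⟩) rfl (h.trans (.head (B := 0)
      (d := ⟨.ret _, R, some .endName :: (passed (bits X) ++ some .var :: L),
      encodeEnv ρ, [], K⟩) rfl ?_))).mono ?_
    · simp [passed, bits, Term.eval]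
      exact .refl _
    · refine le_trans ?_ (Nat.le_mul_of_pos_right _ (hp _))
      unfold overhead
      have : (encodeEnv ρ).length * (2 * X.length + 5) ≤ M * (2 * M + 5) :=
        Nat.mul_le_mul (by omega) (by omega)
      nlinarith
  | un o t ih =>
    have hs : (evaluator I).step ⟨.eval, (Term.un o t).encode ++ R, L, encodeEnv ρ, [], K⟩ =
        .inl ⟨.eval, t.encode ++ R, some o.letter :: L, encodeEnv ρ, [], .un o :: K⟩ := by
      cases o <;> rfl
    simp only [Term.encode, List.length_cons] at hM ⊢
    have h := ih ρ (by omega) R (some o.letter :: L) (.un o :: K)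
    refine (Reach.head hs (h.trans (.head (B := 0)
      (d := ⟨.ret _, R, _, encodeEnv ρ, [], K⟩) rfl ?_))).mono ?_
    · rw [passed_cons]
      exact .refl _
    · have := hp (t.encode (S := S)).length
      have hW : 2 ≤ overhead M := by unfold overhead; nlinarith
      rw [pow_succ]
      nlinarith [Nat.mul_le_mul hW this]
  | bin o t u iht ihu =>
    have hs : (evaluator I).step ⟨.eval, (Term.bin o t u).encode ++ R, L, encodeEnv ρ, [], K⟩ =
        .inl ⟨.eval, t.encode ++ (u.encode ++ R), some o.letter :: L, encodeEnv ρ, [],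
          .binLeft o :: K⟩ := by
      rw [← List.append_assoc]
      cases o <;> rfl
    simp only [Term.encode, List.length_cons, List.length_append] at hM ⊢
    have h := iht ρ (by omega) (u.encode ++ R) (some o.letter :: L) (.binLeft o :: K)
    have h' := ihu ρ (by omega) R (passed t.encode ++ some o.letter :: L)
      (.binRight o (t.eval I ρ) :: K)
    refine (Reach.head hs (h.trans (.head rfl (h'.trans (.head (B := 0)
      (d := ⟨.ret _, R, _, encodeEnv ρ, [], K⟩) rfl ?_))))).mono ?_
    · rw [passed_cons, passed_append, List.append_assoc]
      exact .refl _
    · have h1 := hp (t.encode (S := S)).length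
      have h2 := hp (u.encode (S := S)).length
      have hW : 3 ≤ overhead M := by unfold overhead; nlinarith
      rw [pow_succ, pow_add]
      generalize (2 * N + 5) ^ (t.encode (S := S)).length = a at *
      generalize (2 * N + 5) ^ (u.encode (S := S)).length = b at *
      have e1 : overhead M * a ≤ overhead M * (a * b) :=
        Nat.mul_le_mul_left _ (Nat.le_mul_of_pos_right _ h2)
      have e2 : overhead M * b ≤ overhead M * (a * b) :=
        Nat.mul_le_mul_left _ (Nat.le_mul_of_pos_left _ h1)
      have e3 : overhead M ≤ overhead M * (a * b) :=
        Nat.le_mul_of_pos_right _ (Nat.mul_pos h1 h2)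
      calc _ ≤ overhead M * (a * b) * 5 := by omega
        _ ≤ overhead M * (a * b) * (2 * N + 5) := Nat.mul_le_mul_left _ (by omega)
        _ = _ := by ring
  | bind o X t u iht ihu =>
    have hs : (evaluator I).step ⟨.eval, (Term.bind o X t u).encode ++ R, L, encodeEnv ρ, [], K⟩ =
        .inl ⟨.lookup (some o), bits X ++ .endName :: (t.encode ++ (u.encode ++ R)),
          some o.letter :: L, encodeEnv ρ, [], K⟩ := by
      have : ((Term.bind o X t u).encode ++ R : List (Letter A S)) =
          o.letter :: (bits X ++ .endName :: (t.encode ++ (u.encode ++ R))) := by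
        simp [Term.encode, encodeName, bits]
      rw [this]
      cases o <;> rfl
    have hL : ∀ b, (some (o.letter : Letter A S) :: L).head? ≠ some (some (.bit b)) := by
      cases o <;> simp [BindOp.letter]
    have hlen : ∀ e, (encodeEnv ((X, e) :: ρ)).length = X.length + 1 + (encodeEnv ρ).length := by
      intro e; simp [encodeEnv]; omega
    have hsz : ((Term.bind o X t u).encode : List (Letter A S)).length =
        X.length + 2 + t.encode.length (α := Letter A S) + u.encode.length (α := Letter A S) := by
      simp [Term.encode, encodeName]; omega
    obtain ⟨q, h1⟩ := reach_lookup_forward (I := I) (R := t.encode ++ (u.encode ++ R))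
      (L := some o.letter :: L) (K := K) (some o) X ρ hL
    have h2 := reach_pushName (I := I) (R := .endName :: (t.encode ++ (u.encode ++ R)))
      (L := some o.letter :: L) (E := encodeEnv ρ) (Z := []) (K := K) X o (lookup X ρ) hL
    have h3 := reach_forward (I := I) (R := .endName :: (t.encode ++ (u.encode ++ R)))
      (L := some o.letter :: L) (E := X.map .bit ++ encodeEnv ρ) (Z := []) (K := K) X I.init
      (.bound o (lookup X ρ))
    set L' := some .endName :: (passed (bits X) ++ some o.letter :: L) with hL'
    have h4 := iht ((X, 0) :: ρ) (by rw [hlen]; omega) (u.encode ++ R) L'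
      (.bindTy o (lookup X ρ) :: K)
    have h5 := reach_loop (I := I) (R := R) (L := passed t.encode ++ L') (K := K)
      (fun e R L K => ihu ((X, e) :: ρ) (by rw [hlen]; omega) R L K)
      o (lookup X ρ) (t.eval I ((X, 0) :: ρ)) (Fin.last N)
      -- No index exceeds the last one, so nothing is required of the initial table.
      (fun _ => t.eval I ((X, 0) :: ρ)) (fun j hj => absurd hj (Fin.le_last j).not_gt) 0
    have h6 := reach_popName (I := I) (R := R) (L := passed u.encode ++ (passed t.encode ++ L'))
      (Z := []) (K := K) X ((Term.bind o X t u).eval I ρ) ρ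
    have hend : passed u.encode ++ (passed t.encode ++ L') =
        passed (Term.bind o X t u).encode ++ L := by
      simp [hL', Term.encode, encodeName, passed, bits]
    rw [hend] at h5 h6
    refine (Reach.head hs (h1.trans (.head rfl (h2.trans (h3.trans (.head rfl
      (h4.trans (.head rfl (h5.trans h6))))))))).mono ?_
    rw [hsz] at hM ⊢
    generalize hx : X.length = x at *
    generalize (encodeEnv ρ).length = e at *
    have g1 := hp (t.encode (S := S)).length
    have g2 := hp (u.encode (S := S)).length
    have g3 : (u.encode (S := S)).length ≤ M := by omega
    have g4 : e * (2 * x + 5) ≤ M * (2 * M + 5) := Nat.mul_le_mul (by omega) (by omega)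
    rw [pow_add, pow_add]
    generalize (2 * N + 5) ^ (t.encode (S := S)).length = a at *
    generalize (2 * N + 5) ^ (u.encode (S := S)).length = b at *
    have e0 : e * (2 * x + 5) + 4 * M + 20 ≤ overhead M := by unfold overhead; nlinarith
    have e1 : overhead M * a ≤ overhead M * (a * b) :=
      Nat.mul_le_mul_left _ (Nat.le_mul_of_pos_right _ g2)
    have e2 : overhead M * b ≤ overhead M * (a * b) :=
      Nat.mul_le_mul_left _ (Nat.le_mul_of_pos_left _ g1)
    have e3 : overhead M ≤ overhead M * (a * b) :=
      Nat.le_mul_of_pos_right _ (Nat.mul_pos g1 g2)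
    have e4 : (N + 1) * (overhead M * b + (u.encode (S := S)).length + 3) ≤
        (N + 1) * (overhead M * (a * b) * 2) := Nat.mul_le_mul_left _ (by omega)
    have e5 : 2 * N + 5 ≤ (2 * N + 5) ^ (x + 2) := Nat.le_self_pow (by omega) _
    simp only [Fin.val_last]
    -- With `W = overhead M * (a * b)`, the `N + 1` passes cost at most `2 * W` each, and `3 * W`
    -- covers the type and the local work; hence the base `2 * N + 5`.
    calc _ ≤ overhead M * (a * b) * (2 * N + 5) := by
          have : (N + 1) * (overhead M * (a * b) * 2) = overhead M * (a * b) * (2 * N + 2) := by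
            ring
          have : overhead M * (a * b) * (2 * N + 5) = overhead M * (a * b) * (2 * N + 2) +
            overhead M * (a * b) * 3 := by ring
          omega
      _ ≤ overhead M * (a * b) * (2 * N + 5) ^ (x + 2) := Nat.mul_le_mul_left _ e5
      _ = _ := by ring

end
/-! ### Checking the syntax -/

section
variable {A S V Q : Type} {N : ℕ} {I : Algebra A S V Q N}

open StackMachine

/-- Whether a word is a concatenation of words of the given sorts; in the first argument, whether
it is preceded by the rest of a name. -/
def checkWord : Bool → List Bool → List (Letter A S) → Bool
  | b, ss, [] => !b && ss.isEmpty
  | b, ss, c :: w =>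
      match checkNext b ss.head? c with
      | some (b', a) => checkWord b' (a.run ss) w
      | none => false

theorem checkWord_encodeName (ss : List Bool) (X : Name) (w : List (Letter A S)) :
    checkWord true ss (encodeName X ++ w) = checkWord false ss w := by
  induction X with
  | nil => rfl
  | cons b X ih => exact ih

theorem checkWord_encodeTy (τ : Ty) (ss : List Bool) (w : List (Letter A S)) :
    checkWord false (false :: ss) (encodeTy τ ++ w) = checkWord false ss w := by
  induction τ generalizing ss w with
  | pr => rfl
  | fn σ v τ ih₁ ih₂ =>
    rw [encodeTy, List.cons_append, List.append_assoc]
    exact (ih₁ _ _).trans (ih₂ _ _)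

/-- Every operator replaces the pending sort on top by the sorts of its operands, so a whole formula
consumes exactly that one sort. -/
theorem checkWord_encodeFormula (φ : Formula A) (ss : List Bool) (w : List (Letter A S)) :
    checkWord false (true :: ss) (encodeFormula φ ++ w) = checkWord false ss w := by
  induction φ generalizing ss w with
  | prop q => exact checkWord_encodeName ss q w
  | var X => exact checkWord_encodeName ss X w
  | neg φ ih => exact ih ss w
  | dia a φ ih => exact ih ss w
  | or φ ψ ih₁ ih₂ =>
    rw [encodeFormula, List.cons_append, List.append_assoc]
    exact (ih₁ _ _).trans (ih₂ _ _)
  | app φ ψ ih₁ ih₂ =>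
    rw [encodeFormula, List.cons_append, List.append_assoc]
    exact (ih₁ _ _).trans (ih₂ _ _)
  | lam X v σ φ ih =>
    rw [encodeFormula, List.cons_append, List.append_assoc, List.append_assoc]
    exact (checkWord_encodeName _ _ _).trans ((checkWord_encodeTy _ _ _).trans (ih _ _))
  | mu X τ φ ih =>
    rw [encodeFormula, List.cons_append, List.append_assoc, List.append_assoc]
    exact (checkWord_encodeName _ _ _).trans ((checkWord_encodeTy _ _ _).trans (ih _ _))

/-- A word is a concatenation of formulas (for `true`) and types (for `false`). -/
def Parses (A S : Type) : List Bool → List (Letter A S) → Prop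
  | [], w => w = []
  | true :: ss, w => ∃ φ v, w = encodeFormula φ ++ v ∧ Parses A S ss v
  | false :: ss, w => ∃ τ v, w = encodeTy τ ++ v ∧ Parses A S ss v

/-- After the first letter, the induction hypothesis splits the remaining word according to the
updated sorts; the letter then assembles its operands into one formula or type. -/
theorem parses_of_checkWord (b : Bool) (ss : List Bool) (w : List (Letter A S))
    (h : checkWord b ss w = true) :
    if b then ∃ X v, w = encodeName X ++ v ∧ Parses A S ss v else Parses A S ss w := by
  induction w generalizing b ss with
  | nil =>
    simp only [checkWord, Bool.and_eq_true, Bool.not_eq_true', List.isEmpty_iff] at h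
    obtain ⟨rfl, rfl⟩ := h
    exact rfl
  | cons c w ih =>
    cases b with
    | true =>
      cases c <;> simp only [checkWord, checkNext, Act.run, Bool.false_eq_true] at h
      case bit b =>
        obtain ⟨X, v, rfl, hv⟩ := ih _ _ h
        exact ⟨b :: X, v, rfl, hv⟩
      case endName => exact ⟨[], w, rfl, ih _ _ h⟩
    | false =>
      rcases ss with _ | ⟨_ | _, ss⟩
      · cases c <;> simp [checkWord, checkNext] at h
      · cases c <;> simp only [checkWord, checkNext, Act.run, List.head?_cons, List.tail_cons,
          Bool.false_eq_true] at h
        case pr => exact ⟨.pr, w, rfl, ih _ _ h⟩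
        case arrow v =>
          obtain ⟨σ, _, rfl, τ, u, rfl, hu⟩ := ih _ _ h
          exact ⟨.fn σ v τ, u, by simp [encodeTy], hu⟩
      · cases c <;> simp only [checkWord, checkNext, Act.run, List.head?_cons, List.tail_cons,
          Bool.false_eq_true] at h
        case prop =>
          obtain ⟨X, u, rfl, hu⟩ := ih _ _ h
          exact ⟨.prop X, u, rfl, hu⟩
        case var =>
          obtain ⟨X, u, rfl, hu⟩ := ih _ _ h
          exact ⟨.var X, u, rfl, hu⟩
        case neg =>
          obtain ⟨φ, u, rfl, hu⟩ := ih _ _ h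
          exact ⟨.neg φ, u, rfl, hu⟩
        case dia a =>
          obtain ⟨φ, u, rfl, hu⟩ := ih _ _ h
          exact ⟨.dia a φ, u, rfl, hu⟩
        case or =>
          obtain ⟨φ, _, rfl, ψ, u, rfl, hu⟩ := ih _ _ h
          exact ⟨.or φ ψ, u, by simp [encodeFormula], hu⟩
        case app =>
          obtain ⟨φ, _, rfl, ψ, u, rfl, hu⟩ := ih _ _ h
          exact ⟨.app φ ψ, u, by simp [encodeFormula], hu⟩
        case lam v =>
          obtain ⟨X, _, rfl, σ, _, rfl, φ, u, rfl, hu⟩ := ih _ _ h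
          exact ⟨.lam X v σ φ, u, by simp [encodeFormula], hu⟩
        case mu =>
          obtain ⟨X, _, rfl, σ, _, rfl, φ, u, rfl, hu⟩ := ih _ _ h
          exact ⟨.mu X σ φ, u, by simp [encodeFormula], hu⟩

theorem checkWord_iff (w : List (Letter A S)) :
    checkWord false [true] w = true ↔ ∃ φ, w = encodeFormula φ := by
  constructor
  · intro h
    obtain ⟨φ, v, rfl, hv⟩ := parses_of_checkWord _ _ _ h
    exact ⟨φ, by rw [show v = [] from hv, List.append_nil]⟩
  · rintro ⟨φ, rfl⟩
    simpa [checkWord] using checkWord_encodeFormula φ [] ([] : List (Letter A S))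

/-- The control stack during the check of the syntax. -/
def sorts (ss : List Bool) (s : S) : List (Frame A S V N) := ss.map .sort ++ [.top s]

/-- The control stack mirrors the list of pending sorts; the frame `.top s` carries no sort and so
plays the role of the empty list. -/
theorem step_check {b b' : Bool} {ss : List Bool} {c : Letter A S} {a : Act Bool} {s : S}
    (h : checkNext b ss.head? c = some (b', a)) (w L) :
    (evaluator I).step ⟨.check b, c :: w, L, [], [], sorts ss s⟩ =
      .inl ⟨.check b', w, some c :: L, [], [], sorts (a.run ss) s⟩ := by
  rcases ss with _ | ⟨x, ss⟩
  · cases b <;> cases c <;> simp [checkNext] at h <;> obtain ⟨rfl, rfl⟩ := h <;> rfl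
  · cases b <;> cases x <;> cases c <;> simp [checkNext] at h <;> obtain ⟨rfl, rfl⟩ := h <;> rfl

theorem reach_check (b : Bool) (ss : List Bool) (w : List (Letter A S)) (s : S) (L)
    (h : checkWord b ss w = true) :
    (evaluator I).Reach (w.length + 1) ⟨.check b, w, L, [], [], sorts ss s⟩
      ⟨.rewindAll, [], passed w ++ L, [], [], [.top s]⟩ := by
  induction w generalizing b ss L with
  | nil =>
    simp only [checkWord, Bool.and_eq_true, Bool.not_eq_true', List.isEmpty_iff] at h
    obtain ⟨rfl, rfl⟩ := h
    exact .head rfl (.refl _)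
  | cons c w ih =>
    rw [checkWord] at h
    split at h
    · rename_i b' a hn
      rw [passed_cons]
      exact .head (step_check hn _ _) (ih _ _ _ h)
    · cases h

/-- The factor 3 pays for reading a letter and for later clearing what it may add: one symbol on the
left stack and one pending sort. -/
theorem reach_check_false (b : Bool) (ss : List Bool) (w : List (Letter A S)) (s : S) (L)
    (h : checkWord b ss w = false) :
    (evaluator I).Reach (3 * w.length + L.length + ss.length + 2)
      ⟨.check b, w, L, [], [], sorts ss s⟩ ⟨.clean false, [], [], [], [], []⟩ := by
  induction w generalizing b ss L with
  | nil =>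
    refine .head (d := ⟨.clean false, [], L, [], [], sorts ss s⟩) ?_ (reach_clean _ _ ?_ ?_ ?_ ?_ ?_)
    · rcases ss with _ | ⟨x, ss⟩
      · cases b
        · simp [checkWord] at h
        · rfl
      · cases b <;> rfl
    all_goals simp [sorts]; try omega
  | cons c w ih =>
    rw [checkWord] at h
    split at h
    · rename_i b' a hn
      refine (Reach.head (step_check hn _ _) (ih _ _ _ h)).mono ?_
      have : (a.run ss).length ≤ ss.length + 1 := by
        cases a <;> simp [Act.run]
        all_goals omega
      simp
      omega
    · rename_i hn
      refine .head (d := ⟨.clean false, c :: w, L, [], [], sorts ss s⟩) ?_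
        (reach_clean _ _ ?_ ?_ ?_ ?_ ?_)
      · have : (sorts ss s : List (Frame A S V N)).head?.bind Frame.sort? = ss.head? := by
          cases ss <;> rfl
        simp [StackMachine.step, evaluator, this, hn, reject, Act.run]
      all_goals simp [sorts]; try omega

/-! ### Complete runs and the exponential bound -/

/-- A bound for the time of the evaluating machine on words of length `n`. -/
def timeBound (N n : ℕ) : ℕ := 4 * n + 20 + overhead n * (2 * N + 5) ^ n

theorem reach_accept (s : S) (φ : Formula A) :
    (evaluator I).Reach (timeBound N (Letter.state s :: encodeFormula φ : List (Letter A S)).length)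
      ⟨.init, .state s :: encodeFormula φ, [], [], [], []⟩
      ⟨.clean (I.accept s (φ.toTerm.eval I [])), [], [], [], [], []⟩ := by
  have h1 := reach_check (I := I) false [true] (encodeFormula φ) s [] ((checkWord_iff _).2 ⟨φ, rfl⟩)
  have h2 := reach_rewindAll (I := I) (R := []) (E := []) (Z := []) (K := [.top s])
    (encodeFormula φ)
  have h3 := reach_eval (I := I) φ.toTerm [] (encodeFormula φ : List (Letter A S)).length
    (by simp [encodeEnv, Formula.encode_toTerm]) [] [] [.top s]
  have h4 := reach_clean (I := I) (R := []) (L := passed (encodeFormula φ)) (E := []) (Z := [])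
    (K := []) (I.accept s (φ.toTerm.eval I [])) (encodeFormula φ : List (Letter A S)).length
    (by simp) (by simp [passed]) (by simp) (by simp) (by simp)
  simp only [Formula.encode_toTerm, List.append_nil] at h1 h2 h3
  refine (Reach.head rfl (.head rfl (h1.trans (h2.trans (h3.trans (.head rfl h4)))))).mono ?_
  have : overhead (encodeFormula φ : List (Letter A S)).length ≤
      overhead ((encodeFormula φ : List (Letter A S)).length + 1) :=
    Nat.mul_le_mul_left _ (Nat.pow_le_pow_left (by omega) _)
  have := Nat.mul_le_mul this (Nat.pow_le_pow_right (n := 2 * N + 5) (by omega)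
    (Nat.le_add_right (encodeFormula φ : List (Letter A S)).length 1))
  simp only [timeBound, List.length_cons]
  omega

theorem reach_reject (w : List (Letter A S)) (hw : ¬ ∃ s φ, w = .state s :: encodeFormula φ) :
    (evaluator I).Reach (timeBound N w.length) ⟨.init, w, [], [], [], []⟩
      ⟨.clean false, [], [], [], [], []⟩ := by
  refine Reach.mono (B := 3 * w.length + 6) ?_ (by unfold timeBound; omega)
  by_cases h : ∃ s w', w = .state s :: w'
  · obtain ⟨s, w', rfl⟩ := h
    have h1 := reach_check_false (I := I) false [true] w' s []
      (by rw [Bool.eq_false_iff, Ne, checkWord_iff]; rintro ⟨φ, rfl⟩; exact hw ⟨s, φ, rfl⟩)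
    refine (Reach.head rfl (.head rfl h1)).mono ?_
    simp
    omega
  · refine (Reach.head (d := ⟨.clean false, w, [], [], [], []⟩) ?_
      (reach_clean _ w.length le_rfl ?_ ?_ ?_ ?_)).mono (by omega)
    · rcases w with _ | ⟨c, w⟩
      · rfl
      · cases c <;> first | rfl | exact absurd ⟨_, _, rfl⟩ h
    all_goals simp

/-- Acceptance of formulas by a finite algebra can be decided in exponential time. -/
theorem inEXPTIME_of_algebra [Finite A] [Finite S] [Finite V] [Finite Q] (I : Algebra A S V Q N)
    (W : Language (Letter A S))
    (hW : ∀ w ∈ W, ∃ s φ, w = .state s :: encodeFormula φ ∧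
      I.accept s (φ.toTerm.eval I []) = true)
    (hW' : ∀ s φ, I.accept s (φ.toTerm.eval I []) = true → .state s :: encodeFormula φ ∈ W) :
    InEXPTIME W := by
  refine (evaluator I).inEXPTIME W (4 * .X + 22 + 2 * (.X + 5) ^ 2 + (2 * Polynomial.C N + 5) * .X)
    fun w => ?_
  -- Each summand of the exponent dominates one factor: the linear part, the overhead, and the power
  -- of `2 * N + 5`. The sum in `timeBound` is first bounded by their product.
  have hb : timeBound N w.length + 2 ≤ 2 ^ (4 * .X + 22 + 2 * (.X + 5) ^ 2 +
      (2 * Polynomial.C N + 5) * .X : Polynomial ℕ).eval w.length := by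
    simp only [Polynomial.eval_add, Polynomial.eval_mul, Polynomial.eval_pow, Polynomial.eval_X,
      Polynomial.eval_ofNat, Polynomial.eval_C]
    generalize w.length = n
    have h1 : 4 * n + 22 < 2 ^ (4 * n + 22) := Nat.lt_two_pow_self
    have h2 : 2 * (n + 5) ^ 2 < 2 ^ (2 * (n + 5) ^ 2) := Nat.lt_two_pow_self
    have h3 : (2 * N + 5) ^ n ≤ 2 ^ ((2 * N + 5) * n) := by
      rw [pow_mul]
      exact Nat.pow_le_pow_left Nat.lt_two_pow_self.le n
    have h4 : 1 ≤ 2 ^ ((2 * N + 5) * n) := Nat.one_le_two_pow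
    rw [pow_add, pow_add]
    unfold timeBound overhead
    calc _ = 4 * n + 22 + 2 * (n + 5) ^ 2 * (2 * N + 5) ^ n := by ring
      _ ≤ 4 * n + 22 + 2 * (n + 5) ^ 2 * 2 ^ ((2 * N + 5) * n) := by gcongr
      _ ≤ (4 * n + 22) * (2 * (n + 5) ^ 2) * 2 ^ ((2 * N + 5) * n) := by
        generalize 2 ^ ((2 * N + 5) * n) = p at *
        have h5 : 2 * (n + 5) ^ 2 ≥ 2 := by nlinarith
        generalize 2 * (n + 5) ^ 2 = y at *
        generalize hx : 4 * n + 22 = x at *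
        have : x + y ≤ x * y := by nlinarith
        nlinarith [Nat.mul_le_mul_right p this]
      _ ≤ _ := by gcongr
  by_cases hw : w ∈ W
  · obtain ⟨s, φ, rfl, ha⟩ := hW w hw
    obtain ⟨n, hn, hr⟩ := reach_accept (I := I) s φ
    exact ⟨n, _, _, hr, rfl, ⟨fun _ => hw, fun _ => ha⟩, by omega⟩
  by_cases h : ∃ s φ, w = .state s :: encodeFormula φ
  · obtain ⟨s, φ, rfl⟩ := h
    obtain ⟨n, hn, hr⟩ := reach_accept (I := I) s φ
    exact ⟨n, _, _, hr, rfl, ⟨hW' s φ, fun h => absurd h hw⟩, by omega⟩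
  · obtain ⟨n, hn, hr⟩ := reach_reject (I := I) w h
    exact ⟨n, _, _, hr, rfl, ⟨fun h => absurd h (by simp), fun h => absurd h hw⟩, by omega⟩

end
/-! ### Finiteness -/

/-- Induction on the arity: splitting off the first argument leaves a type of smaller arity, and the
argument has smaller order, so it is one of finitely many by `h`. -/
theorem finite_types_arity (k m r : ℕ)
    (h : ∀ j < k, (Types j m).Finite) : {τ ∈ Types k m | τ.arity ≤ r}.Finite := by
  induction r with
  | zero =>
    refine (Set.finite_singleton Ty.pr).subset fun τ hτ => ?_
    cases τ with
    | pr => rfl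
    | fn σ v τ => simp [Ty.arity] at hτ
  | succ r ih =>
    have hfin : ((⋃ j ∈ Set.Iio k, Types j m) ×ˢ (Set.univ : Set Variance) ×ˢ
        {τ ∈ Types k m | τ.arity ≤ r}).Finite :=
      ((Set.finite_Iio k).biUnion h).prod (Set.finite_univ.prod ih)
    refine ((hfin.image fun x => Ty.fn x.1 x.2.1 x.2.2).insert .pr).subset fun τ hτ => ?_
    cases τ with
    | pr => exact Set.mem_insert _ _
    | fn σ v τ =>
      obtain ⟨⟨h1, h2⟩, h3⟩ := hτ
      simp only [Ty.order, Ty.maxArity, Ty.arity, max_le_iff] at h1 h2 h3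
      refine Set.mem_insert_of_mem _ ⟨(σ, v, τ), ⟨?_, trivial, ⟨h1.2, h2.2.2⟩,
        Nat.le_of_succ_le_succ h3⟩, rfl⟩
      exact Set.mem_biUnion (show k - 1 < k by omega)
        ⟨show σ.order ≤ k - 1 by omega, h2.2.1⟩

theorem arity_le_maxArity (τ : Ty) : τ.arity ≤ τ.maxArity := by
  cases τ with
  | pr => exact le_rfl
  | fn σ v τ => exact le_max_left _ _

theorem finite_types (k m : ℕ) : (Types k m).Finite := by
  induction k using Nat.strong_induction_on with
  | _ k ih =>
    exact (finite_types_arity k m m ih).subset fun τ hτ => ⟨hτ, (arity_le_maxArity τ).trans hτ.2⟩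

/-! ### Finiteness of the lattices -/

theorem Den.ext {S : Type} {σ τ : Ty} {v : Variance} {f g : Den S (.fn σ v τ)}
    (h : ∀ x, f.apply x = g.apply x) : f = g := by
  let := (lattice S σ).2
  let := (lattice S τ).2
  exact OrderHom.ext (α := VOrd v (lattice S σ).1) (β := (lattice S τ).1) f g (funext h)

instance Den.finite {S : Type} [Finite S] (τ : Ty) : Finite (Den S τ) := by
  induction τ with
  | pr => exact inferInstanceAs (Finite (Set S))
  | fn σ v τ ih₁ ih₂ =>
    exact Finite.of_injective (fun (f : Den S (.fn σ v τ)) => f.apply)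
      fun f g h => Den.ext fun x => congrFun h x

/-- Only uniqueness is available: the pointwise complement of a monotone function need not be
monotone. -/
theorem IsComplement.unique {S : Type} {τ : Ty} {f g d : Den S τ} (hf : IsComplement τ f d)
    (hg : IsComplement τ g d) : f = g := by
  induction τ with
  | pr => exact Eq.trans (b := (d.toSetᶜ : Set S)) hf hg.symm
  | fn σ v τ ih₁ ih₂ => exact Den.ext fun x => ih₂ (hf x) (hg x)

theorem Types.mem_of_fn {k m : ℕ} {σ τ : Ty} {v : Variance} (h : Ty.fn σ v τ ∈ Types k m) :
    σ ∈ Types k m ∧ τ ∈ Types k m := by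
  obtain ⟨h1, h2⟩ := h
  simp only [Ty.order, Ty.maxArity, max_le_iff] at h1 h2
  exact ⟨⟨by omega, h2.2.1⟩, ⟨h1.2, h2.2.2⟩⟩

theorem Types.pr_mem (k m : ℕ) : Ty.pr ∈ Types k m := ⟨Nat.zero_le _, Nat.zero_le _⟩

/-! ### Typing and semantics -/

theorem HasType.mem {A : Type} {U : Set Ty} {Γ : Ctx} {φ : Formula A} {τ : Ty}
    (h : HasType U Γ φ τ) : τ ∈ U := by
  cases h <;> assumption

/-- The type of a formula is unique. -/
theorem HasType.eq_of_sem {A S : Type} {U : Set Ty} {T : LTS A S} {Γ : Ctx} {φ : Formula A}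
    {τ : Ty} (h : HasType U Γ φ τ) {η : Env S} {τ' : Ty} {d : Den S τ'}
    (hc : ∀ X v τ x, Γ X = some (v, τ) → η X = some x → τ = x.1)
    (hs : Sem T η φ τ' d) : τ = τ' := by
  -- Complementing a context changes variances only, so its types still agree with the environment.
  have hcompl : ∀ {Γ : Ctx} {η : Env S},
      (∀ X v τ x, Γ X = some (v, τ) → η X = some x → τ = x.1) →
      ∀ X v τ x, Γ.compl X = some (v, τ) → η X = some x → τ = x.1 := by
    intro Γ η hc X v τ x hX hx
    simp only [Ctx.compl, Option.map_eq_some_iff] at hX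
    obtain ⟨⟨w, _⟩, hw, he⟩ := hX
    obtain ⟨rfl, rfl⟩ := Prod.mk.inj he
    exact hc X w _ x hw hx
  have hext : ∀ {Γ : Ctx} {η : Env S} (Y : Name) (v : Variance) (σ : Ty) (y : Den S σ),
      (∀ X v τ x, Γ X = some (v, τ) → η X = some x → τ = x.1) →
      ∀ X w τ x, Γ.extend Y v σ X = some (w, τ) → η.set Y y X = some x → τ = x.1 := by
    intro Γ η Y v σ y hc X w τ x hX hx
    by_cases hXY : X = Y
    · subst hXY
      simp only [Ctx.extend, Env.set, Function.update_self, Option.some.injEq,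
        Prod.mk.injEq] at hX hx
      rw [← hX.2, ← hx]
    · simp only [Ctx.extend, Env.set, Function.update_of_ne hXY] at hX hx
      exact hc X w τ x hX hx
  induction h generalizing η τ' with
  | prop => cases hs; rfl
  | var _ hX _ => cases hs with | var hη => exact hc _ _ _ _ hX hη
  | neg _ _ ih => cases hs with | neg hs _ => exact ih (hcompl hc) hs
  | or => cases hs; rfl
  | dia => cases hs; rfl
  | lam _ _ _ ih =>
    cases hs with
    -- Any argument would determine the type of the body; `⊤` is one that exists in every lattice.
    | lam hs => rw [ih (hext _ _ _ ⊤ hc) (hs ⊤)]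
  | appPos _ _ _ ih => cases hs with | app hs _ => exact (Ty.fn.inj (ih hc hs)).2.2
  | appNeg _ _ _ ih => cases hs with | app hs _ => exact (Ty.fn.inj (ih hc hs)).2.2
  | appZero _ _ _ _ ih => cases hs with | app hs _ => exact (Ty.fn.inj (ih hc hs)).2.2
  | mu => cases hs; rfl

/-! ### The algebra of typed values -/

section
variable {A S : Type} {k m N : ℕ}

/-- The elements of all lattices of types from `Types k m`. -/
abbrev Val (S : Type) (k m : ℕ) : Type := {x : (τ : Ty) × Den S τ // x.1 ∈ Types k m}

instance [Finite S] : Finite (Val S k m) := by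
  have : Finite {τ // τ ∈ Types k m} := finite_types k m
  exact Finite.of_injective
    (fun x => (⟨⟨x.1.1, x.2⟩, x.1.2⟩ : (τ : {τ // τ ∈ Types k m}) × Den S τ))
    fun ⟨⟨τ, d⟩, h⟩ ⟨⟨τ', d'⟩, h'⟩ he => by
      simp only [Sigma.mk.injEq, Subtype.mk.injEq] at he
      exact Subtype.ext (Sigma.ext he.1 he.2)

/-- A result of an evaluation is a given element. -/
def IsVal (o : Option (Val S k m)) (x : (τ : Ty) × Den S τ) : Prop := o.map Subtype.val = some x

theorem IsVal.unique {o : Option (Val S k m)} {x y : (τ : Ty) × Den S τ} (hx : IsVal o x)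
    (hy : IsVal o y) : x = y :=
  Option.some.inj (hx.symm.trans hy)

theorem IsVal.unique' {o : Option (Val S k m)} {τ : Ty} {x y : Den S τ} (hx : IsVal o ⟨τ, x⟩)
    (hy : IsVal o ⟨τ, y⟩) : x = y :=
  eq_of_heq (Sigma.mk.inj (hx.unique hy)).2

open Classical in
/-- The element with a given property, if there is one. -/
noncomputable def pick (P : (τ : Ty) × Den S τ → Prop) : Option (Val S k m) :=
  if h : ∃ x : Val S k m, P x.1 then some h.choose else none

/-- The choice in `pick` is harmless when `P` has at most one solution; the uniqueness premise is
checked for every construct of the logic. -/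
theorem isVal_pick {P : (τ : Ty) × Den S τ → Prop} (hP : ∀ x y, P x → P y → x = y)
    {x : (τ : Ty) × Den S τ} : IsVal (pick P : Option (Val S k m)) x ↔ x.1 ∈ Types k m ∧ P x := by
  unfold pick IsVal
  split
  · rename_i h
    simp only [Option.map_some, Option.some.injEq]
    constructor
    · rintro rfl
      exact ⟨h.choose.2, h.choose_spec⟩
    · rintro ⟨_, hx⟩
      exact hP _ _ h.choose_spec hx
  · rename_i h
    simp only [Option.map_none, reduceCtorEq, false_iff]
    exact fun ⟨hU, hx⟩ => h ⟨⟨x, hU⟩, hx⟩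

attribute [irreducible] pick

/-- The variance in a context (for `true`) or its complement (for `false`). -/
def Variance.twist : Bool → Variance → Variance
  | true, v => v
  | false, v => v.compl

theorem Variance.compl_compl (v : Variance) : v.compl.compl = v := by cases v <;> rfl

theorem Variance.twist_twist (p : Bool) (v : Variance) : (v.twist p).twist p = v := by
  cases p
  · exact v.compl_compl
  · rfl

theorem Variance.twist_not (p : Bool) (v : Variance) : v.twist (!p) = (v.twist p).compl := by
  cases p
  · exact v.compl_compl.symm
  · rfl

/-- The values of terms. The first component is the value of a type, the second one consists of the
values of a formula in a context and in its complement. -/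
abbrev TermVal (S : Type) (k m : ℕ) : Type :=
  Option {τ // τ ∈ Types k m} × (Bool → Option (Val S k m))

instance [Finite S] : Finite (TermVal S k m) := by
  have : Finite {τ // τ ∈ Types k m} := finite_types k m
  infer_instance

open Classical in
/-- The value of a type. -/
noncomputable def tyVal (k m : ℕ) (τ : Ty) : Option {τ // τ ∈ Types k m} :=
  if h : τ ∈ Types k m then some ⟨τ, h⟩ else none

/-- The words of bounded length. -/
abbrev ShortName (B : ℕ) : Type := {X : Name // X.length ≤ B}

instance (B : ℕ) : Finite (ShortName B) := List.finite_length_le Bool B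

/-- Reading a bit, when only the first `B` bits of a name are stored. -/
def ShortName.read {B : ℕ} (X : ShortName B) (b : Bool) : ShortName B :=
  ⟨(X.1 ++ [b]).take B, List.length_take_le _ _⟩

/-- A finite automaton cannot store a name of unbounded length, but a long enough prefix decides
membership in finitely many labels. -/
theorem ShortName.foldl_read {B : ℕ} (X : Name) :
    (X.foldl ShortName.read (⟨[], Nat.zero_le _⟩ : ShortName B)).1 = X.take B := by
  induction X using List.reverseRecOn with
  | nil => simp
  | append_singleton X b ih =>
    simp only [List.foldl_append, List.foldl_cons, List.foldl_nil, ShortName.read, ih,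
      List.take_append, List.length_take, List.take_take, min_self]
    congr 1
    rcases le_total B X.length with h | h
    · simp [h]
    · simp [h]

open Classical in
/-- The algebra of typed values over a transition system. The variables range over the pairs of a
variance and a value; the propositions of `T` must have length less than `B`. -/
noncomputable def typedAlgebra (T : LTS A S) (e : Fin (N + 1) ≃ Variance × Val S k m) (B : ℕ) :
    Algebra A S (TermVal S k m) (ShortName B) N where
  pr := (tyVal k m .pr, fun _ => none)
  un o a := match o with
    | .neg => (none, fun p => pick fun x =>
        ∃ d, IsVal (a.2 !p) ⟨x.1, d⟩ ∧ IsComplement x.1 x.2 d)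
    | .dia l => (none, fun p => pick fun x =>
        ∃ d, IsVal (a.2 p) ⟨.pr, d⟩ ∧ x = ⟨.pr, Den.ofSet {s | ∃ t, T.trans l s t ∧ t ∈ d.toSet}⟩)
  bin o a b := match o with
    | .or => (none, fun p => pick fun x => ∃ d d', IsVal (a.2 p) ⟨.pr, d⟩ ∧
        IsVal (b.2 p) ⟨.pr, d'⟩ ∧ x = ⟨.pr, Den.ofSet (d.toSet ∪ d'.toSet)⟩)
    -- The variance selects the contexts in which the argument is typed, both of them for `0`. At
    -- least one condition is always active, so `d` is determined.
    | .app => (none, fun p => pick fun x => ∃ σ v τ f d, IsVal (a.2 p) ⟨.fn σ v τ, f⟩ ∧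
        (v ≠ .neg → IsVal (b.2 p) ⟨σ, d⟩) ∧ (v ≠ .pos → IsVal (b.2 !p) ⟨σ, d⟩) ∧
        x = ⟨τ, f.apply d⟩)
    | .arrow v => (a.1.bind fun σ => b.1.bind fun τ => tyVal k m (.fn σ v τ), fun _ => none)
  init := ⟨[], Nat.zero_le _⟩
  read := ShortName.read
  prop q := (none, fun _ => pick fun x => x = ⟨.pr, Den.ofSet {s | q.1 ∈ T.label s}⟩)
  var o := (none, fun p => pick fun x =>
    ∃ i, o = some i ∧ (e i).2.1 = x ∧ (e i).1.twist p ≠ .neg)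
  -- The condition `r = none` expresses that the bound variable is new to the context. Variances are
  -- stored relative to the context for `true`, hence the twist by `p`.
  bind o r a f := match o with
    | .lam v => (none, fun p => pick fun x => ∃ (σ τ : Ty) (g : Den S (.fn σ v τ))
        (h : σ ∈ Types k m), r = none ∧ a.1 = some ⟨σ, h⟩ ∧
        (∀ y : Den S σ, IsVal ((f (e.symm (v.twist p, ⟨⟨σ, y⟩, h⟩))).2 p) ⟨τ, g.apply y⟩) ∧
        x = ⟨.fn σ v τ, g⟩)
    | .mu => (none, fun p => pick fun x => ∃ (τ : Ty) (g : Den S τ → Den S τ)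
        (h : τ ∈ Types k m), r = none ∧ a.1 = some ⟨τ, h⟩ ∧
        (∀ y : Den S τ, IsVal ((f (e.symm (Variance.pos.twist p, ⟨⟨τ, y⟩, h⟩))).2 p) ⟨τ, g y⟩) ∧
        x = ⟨τ, sInf {y | g y ≤ y}⟩)
  accept s a := decide (∃ d, IsVal (a.2 true) ⟨.pr, d⟩ ∧ s ∈ d.toSet)

variable {T : LTS A S} {e : Fin (N + 1) ≃ Variance × Val S k m} {B : ℕ}

/-- Both components of an allowed function type are allowed, so rejecting a type at its first
forbidden component loses nothing. -/
theorem eval_toTerm_ty (τ : Ty) (ρ : List (Name × Fin (N + 1))) :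
    ((τ.toTerm : Term A).eval (typedAlgebra T e B) ρ).1 = tyVal k m τ := by
  induction τ with
  | pr => rfl
  | fn σ v τ ih₁ ih₂ =>
    have : ((Ty.fn σ v τ).toTerm.eval (typedAlgebra T e B) ρ).1 =
        (σ.toTerm.eval (typedAlgebra T e B) ρ).1.bind fun σ =>
          (τ.toTerm.eval (typedAlgebra T e B) ρ).1.bind fun τ => tyVal k m (.fn σ v τ) := rfl
    rw [this, ih₁, ih₂]
    by_cases h₁ : σ ∈ Types k m
    · by_cases h₂ : τ ∈ Types k m
      · simp [tyVal, h₁, h₂]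
      · have : Ty.fn σ v τ ∉ Types k m := fun h => h₂ (Types.mem_of_fn h).2
        simp [tyVal, h₁, h₂, this]
    · have : Ty.fn σ v τ ∉ Types k m := fun h => h₁ (Types.mem_of_fn h).1
      simp [tyVal, h₁, this]

/-- The context (for `true`) given by a list of bindings, or its complement (for `false`). -/
def toCtx (e : Fin (N + 1) ≃ Variance × Val S k m) (p : Bool) (ρ : List (Name × Fin (N + 1))) :
    Ctx :=
  fun X => (lookup X ρ).map fun i => ((e i).1.twist p, (e i).2.1.1)

/-- The environment given by a list of bindings. -/
def toEnv (e : Fin (N + 1) ≃ Variance × Val S k m) (ρ : List (Name × Fin (N + 1))) : Env S :=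
  fun X => (lookup X ρ).map fun i => (e i).2.1

theorem toCtx_compl (p : Bool) (ρ : List (Name × Fin (N + 1))) :
    (toCtx e p ρ).compl = toCtx e (!p) ρ := by
  funext X
  simp [Ctx.compl, toCtx, Variance.twist_not, Function.comp_def]

theorem toCtx_extend (p : Bool) (ρ : List (Name × Fin (N + 1))) (X : Name) (v : Variance)
    (x : Val S k m) :
    (toCtx e p ρ).extend X v x.1.1 = toCtx e p ((X, e.symm (v.twist p, x)) :: ρ) := by
  funext Y
  by_cases h : X = Y
  · subst h
    simp [Ctx.extend, toCtx, lookup, Variance.twist_twist]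
  · simp [Ctx.extend, toCtx, lookup, h, Function.update_of_ne (Ne.symm h)]

/-- The variance `v` is arbitrary because environments ignore it; this lets the same binding serve
for the context and for the environment. -/
theorem toEnv_set (ρ : List (Name × Fin (N + 1))) (X : Name) (v : Variance)
    (x : Val S k m) :
    (toEnv e ρ).set X x.1.2 = toEnv e ((X, e.symm (v, x)) :: ρ) := by
  funext Y
  by_cases h : X = Y
  · subst h
    simp [Env.set, toEnv, lookup]
  · simp [Env.set, toEnv, lookup, h, Function.update_of_ne (Ne.symm h)]

theorem toCtx_eq_none (p : Bool) (ρ : List (Name × Fin (N + 1))) (X : Name) :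
    toCtx e p ρ X = none ↔ lookup X ρ = none := by
  simp [toCtx]

theorem toCtx_consistent (p : Bool) (ρ : List (Name × Fin (N + 1))) (X : Name) (v : Variance)
    (τ : Ty) (x : (τ : Ty) × Den S τ) (h : toCtx e p ρ X = some (v, τ))
    (h' : toEnv e ρ X = some x) : τ = x.1 := by
  simp only [toCtx, toEnv, Option.map_eq_some_iff] at h h'
  obtain ⟨i, hi, hv⟩ := h
  obtain ⟨j, hj, rfl⟩ := h'
  obtain rfl : i = j := Option.some.inj (hi.symm.trans hj)
  exact (Prod.mk.inj hv).2.symm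

/-- The evaluation in the algebra of typed values is correct. -/
theorem isVal_eval (hB : ∀ s, ∀ q ∈ T.label s, q.length < B) (φ : Formula A) (p : Bool)
    (ρ : List (Name × Fin (N + 1))) (τ : Ty) (d : Den S τ) :
    IsVal ((φ.toTerm.eval (typedAlgebra T e B) ρ).2 p) ⟨τ, d⟩ ↔
      HasType (Types k m) (toCtx e p ρ) φ τ ∧ Sem T (toEnv e ρ) φ τ d := by
  induction φ generalizing p ρ τ d with
  | prop q =>
    refine (isVal_pick (by rintro x y rfl rfl; rfl)).trans ?_
    -- A truncated name has length exactly `B`, so it cannot coincide with a label, all labels being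
    -- shorter.
    have hq : {s | (q.foldl ShortName.read (⟨[], Nat.zero_le _⟩ : ShortName B)).1 ∈ T.label s} =
        {s | q ∈ T.label s} := by
      ext s
      simp only [ShortName.foldl_read, Set.mem_ofPred_eq]
      constructor
      · intro h
        have h1 := hB s _ h
        rw [List.length_take] at h1
        rwa [List.take_of_length_le (by omega)] at h
      · intro h
        rwa [List.take_of_length_le (hB s _ h).le]
    constructor
    · rintro ⟨h, hx⟩
      obtain ⟨rfl, hx⟩ := Sigma.mk.inj hx
      obtain rfl := eq_of_heq hx
      exact ⟨.prop h, hq ▸ .prop⟩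
    · rintro ⟨h, hs⟩
      cases hs
      exact ⟨h.mem, congrArg (fun D => (⟨.pr, Den.ofSet D⟩ : (τ : Ty) × Den S τ)) hq.symm⟩
  | var X =>
    refine (isVal_pick ?_).trans ?_
    · rintro x y ⟨i, hi, rfl, _⟩ ⟨j, hj, rfl, _⟩
      rw [Option.some.inj (hi.symm.trans hj)]
    · constructor
      · rintro ⟨h, i, hi, hx, hv⟩
        refine ⟨.var (v := (e i).1.twist p) h ?_ ?_, .var ?_⟩
        · simp [toCtx, hi, hx]
        · generalize (e i).1.twist p = v at hv
          cases v <;> simp at hv ⊢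
        · simp [toEnv, hi, hx]
      · rintro ⟨ht, hs⟩
        cases hs with
        | var hη =>
        cases ht with
        | var h hΓ hv =>
        simp only [toCtx, toEnv, Option.map_eq_some_iff] at hη hΓ
        obtain ⟨i, hi, hx⟩ := hη
        obtain ⟨j, hj, hy⟩ := hΓ
        obtain rfl : i = j := Option.some.inj (hi.symm.trans hj)
        refine ⟨h, i, hi, hx, ?_⟩
        rw [(Prod.mk.inj hy).1]
        rcases hv with rfl | rfl <;> simp
  | neg φ ih =>
    refine (isVal_pick ?_).trans ?_
    · rintro ⟨τ, x⟩ ⟨τ', y⟩ ⟨d, hd, hx⟩ ⟨d', hd', hy⟩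
      obtain ⟨rfl, h⟩ := Sigma.mk.inj (hd.unique hd')
      obtain rfl := eq_of_heq h
      exact Sigma.ext rfl (heq_of_eq (hx.unique hy))
    · constructor
      · rintro ⟨h, d', hd, hc⟩
        obtain ⟨ht, hs⟩ := (ih _ _ _ _).1 hd
        rw [← toCtx_compl] at ht
        exact ⟨.neg h ht, .neg hs hc⟩
      · rintro ⟨ht, hs⟩
        cases hs with
        | neg hs hc =>
        cases ht with
        | neg h ht =>
        rw [toCtx_compl] at ht
        exact ⟨h, _, (ih _ _ _ _).2 ⟨ht, hs⟩, hc⟩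
  | dia l φ ih =>
    refine (isVal_pick ?_).trans ?_
    · rintro x y ⟨d, hd, rfl⟩ ⟨d', hd', rfl⟩
      rw [hd.unique' hd']
    · constructor
      · rintro ⟨h, d', hd, hx⟩
        obtain ⟨rfl, hx⟩ := Sigma.mk.inj hx
        obtain rfl := eq_of_heq hx
        obtain ⟨ht, hs⟩ := (ih _ _ _ _).1 hd
        exact ⟨.dia h ht, .dia hs⟩
      · rintro ⟨ht, hs⟩
        cases hs with
        | dia hs =>
        cases ht with
        | dia h ht => exact ⟨h, _, (ih _ _ _ _).2 ⟨ht, hs⟩, rfl⟩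
  | or φ ψ ih₁ ih₂ =>
    refine (isVal_pick ?_).trans ?_
    · rintro x y ⟨d₁, d₂, h₁, h₂, rfl⟩ ⟨d₁', d₂', h₁', h₂', rfl⟩
      rw [h₁.unique' h₁', h₂.unique' h₂']
    · constructor
      · rintro ⟨h, d₁, d₂, h₁, h₂, hx⟩
        obtain ⟨rfl, hx⟩ := Sigma.mk.inj hx
        obtain rfl := eq_of_heq hx
        obtain ⟨ht₁, hs₁⟩ := (ih₁ _ _ _ _).1 h₁
        obtain ⟨ht₂, hs₂⟩ := (ih₂ _ _ _ _).1 h₂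
        exact ⟨.or h ht₁ ht₂, .or hs₁ hs₂⟩
      · rintro ⟨ht, hs⟩
        cases hs with
        | or hs₁ hs₂ =>
        cases ht with
        | or h ht₁ ht₂ =>
          exact ⟨h, _, _, (ih₁ _ _ _ _).2 ⟨ht₁, hs₁⟩, (ih₂ _ _ _ _).2 ⟨ht₂, hs₂⟩, rfl⟩
  | app φ ψ ih₁ ih₂ =>
    refine (isVal_pick ?_).trans ?_
    · rintro x y ⟨σ, v, τ, f, d, hf, h₁, h₂, rfl⟩ ⟨σ', v', τ', f', d', hf', h₁', h₂', rfl⟩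
      have he := hf.unique hf'
      obtain ⟨rfl, rfl, rfl⟩ := Ty.fn.inj (Sigma.mk.inj he).1
      obtain rfl := hf.unique' hf'
      suffices d = d' by rw [this]
      -- Whatever `v` is, one of the two conditions on the argument applies and fixes its value.
      by_cases hv : v = .neg
      · subst hv
        exact (h₂ (by simp)).unique' (h₂' (by simp))
      · exact (h₁ hv).unique' (h₁' hv)
    · constructor
      · rintro ⟨h, σ, v, τ', f, y, hf, h₁, h₂, hx⟩
        obtain ⟨rfl, hx⟩ := Sigma.mk.inj hx
        obtain rfl := eq_of_heq hx
        obtain ⟨ht, hs⟩ := (ih₁ _ _ _ _).1 hf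
        rw [ih₂] at h₁ h₂
        rw [← toCtx_compl] at h₂
        cases v
        · obtain ⟨ht', hs'⟩ := h₁ (by simp)
          exact ⟨.appPos h ht ht', .app hs hs'⟩
        · obtain ⟨ht', hs'⟩ := h₂ (by simp)
          exact ⟨.appNeg h ht ht', .app hs hs'⟩
        · obtain ⟨ht', hs'⟩ := h₁ (by simp)
          exact ⟨.appZero h ht ht' (h₂ (by simp)).1, .app hs hs'⟩
      · rintro ⟨ht, hs⟩
        cases hs with
        | app hs₁ hs₂ =>
        cases ht with
        | appPos h ht₁ ht₂ =>
          -- Typing and semantics choose the argument type and the variance independently;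
          -- uniqueness of the function's type identifies the choices.
          obtain ⟨rfl, rfl, -⟩ := Ty.fn.inj (ht₁.eq_of_sem (toCtx_consistent p ρ) hs₁)
          exact ⟨h, _, _, _, _, _, (ih₁ _ _ _ _).2 ⟨ht₁, hs₁⟩,
            fun _ => (ih₂ _ _ _ _).2 ⟨ht₂, hs₂⟩, fun h => absurd rfl h, rfl⟩
        | appNeg h ht₁ ht₂ =>
          obtain ⟨rfl, rfl, -⟩ := Ty.fn.inj (ht₁.eq_of_sem (toCtx_consistent p ρ) hs₁)
          rw [toCtx_compl] at ht₂
          exact ⟨h, _, _, _, _, _, (ih₁ _ _ _ _).2 ⟨ht₁, hs₁⟩,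
            fun h => absurd rfl h, fun _ => (ih₂ _ _ _ _).2 ⟨ht₂, hs₂⟩, rfl⟩
        | appZero h ht₁ ht₂ ht₃ =>
          obtain ⟨rfl, rfl, -⟩ := Ty.fn.inj (ht₁.eq_of_sem (toCtx_consistent p ρ) hs₁)
          rw [toCtx_compl] at ht₃
          exact ⟨h, _, _, _, _, _, (ih₁ _ _ _ _).2 ⟨ht₁, hs₁⟩,
            fun _ => (ih₂ _ _ _ _).2 ⟨ht₂, hs₂⟩, fun _ => (ih₂ _ _ _ _).2 ⟨ht₃, hs₂⟩, rfl⟩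
  | lam X v σ φ ih =>
    refine (isVal_pick ?_).trans ?_
    · rintro x y ⟨σ₁, τ, g, hσ, -, ha, hg, rfl⟩ ⟨σ₂, τ', g', hσ', -, ha', hg', rfl⟩
      obtain rfl : σ₁ = σ₂ := congrArg Subtype.val (Option.some.inj (ha.symm.trans ha'))
      -- The value of the body at `⊤` already reveals the result type.
      obtain rfl : τ = τ' := (Sigma.mk.inj ((hg ⊤).unique (hg' ⊤))).1
      rw [Den.ext fun y => (hg y).unique' (hg' y)]
    · simp only [eval_toTerm_ty]
      constructor
      · rintro ⟨h, σ', τ', g, hσ, hr, ha, hg, hx⟩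
        obtain ⟨rfl, hx⟩ := Sigma.mk.inj hx
        obtain rfl := eq_of_heq hx
        rw [tyVal] at ha
        split at ha
        · cases ha
          have hg' := fun y => (ih _ _ _ _).1 (hg y)
          refine ⟨.lam h ((toCtx_eq_none _ _ _).2 hr) ?_, .lam fun y => ?_⟩
          · exact toCtx_extend (e := e) p ρ X v ⟨⟨σ, ⊤⟩, hσ⟩ ▸ (hg' ⊤).1
          · exact toEnv_set (e := e) ρ X (v.twist p) ⟨⟨σ, y⟩, hσ⟩ ▸ (hg' y).2
        · cases ha
      · rintro ⟨ht, hs⟩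
        cases hs with
        | lam hs =>
        cases ht with
        | lam h hX ht =>
        have hσ := (Types.mem_of_fn h).1
        refine ⟨h, σ, _, _, hσ, (toCtx_eq_none _ _ _).1 hX, dif_pos hσ, fun y => (ih _ _ _ _).2
          ⟨?_, ?_⟩, rfl⟩
        · exact toCtx_extend (e := e) p ρ X v ⟨⟨σ, y⟩, hσ⟩ ▸ ht
        · exact toEnv_set (e := e) ρ X (v.twist p) ⟨⟨σ, y⟩, hσ⟩ ▸ hs y
  | mu X σ φ ih =>
    refine (isVal_pick ?_).trans ?_
    · rintro x y ⟨σ₁, g, hσ, -, ha, hg, rfl⟩ ⟨σ₂, g', hσ', -, ha', hg', rfl⟩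
      obtain rfl : σ₁ = σ₂ := congrArg Subtype.val (Option.some.inj (ha.symm.trans ha'))
      rw [funext fun y => (hg y).unique' (hg' y)]
    · simp only [eval_toTerm_ty]
      constructor
      · rintro ⟨h, σ', g, hσ, hr, ha, hg, hx⟩
        obtain ⟨rfl, hx⟩ := Sigma.mk.inj hx
        obtain rfl := eq_of_heq hx
        rw [tyVal] at ha
        split at ha
        · cases ha
          have hg' := fun y => (ih _ _ _ _).1 (hg y)
          refine ⟨.mu h ((toCtx_eq_none _ _ _).2 hr) ?_, .mu fun y => ?_⟩
          · exact toCtx_extend (e := e) p ρ X .pos ⟨⟨σ, ⊤⟩, hσ⟩ ▸ (hg' ⊤).1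
          · exact toEnv_set (e := e) ρ X (Variance.pos.twist p) ⟨⟨σ, y⟩, hσ⟩ ▸ (hg' y).2
        · cases ha
      · rintro ⟨ht, hs⟩
        cases hs with
        | mu hs =>
        cases ht with
        | mu h hX ht =>
        refine ⟨h, σ, _, h, (toCtx_eq_none _ _ _).1 hX, dif_pos h, fun y => (ih _ _ _ _).2
          ⟨?_, ?_⟩, rfl⟩
        · exact toCtx_extend (e := e) p ρ X .pos ⟨⟨σ, y⟩, h⟩ ▸ ht
        · exact toEnv_set (e := e) ρ X (Variance.pos.twist p) ⟨⟨σ, y⟩, h⟩ ▸ hs y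

end

/-- The model checking problem of `HFL(k,m)` on a fixed finite transition system is in
`EXPTIME`. -/
theorem inEXPTIME_modelChecking (k m : ℕ) {A S : Type} [Finite A] [Finite S] (T : LTS A S) :
    InEXPTIME (modelChecking T k m) := by
  obtain ⟨n, ⟨e⟩⟩ := Finite.exists_equiv_fin (Variance × Val S k m)
  -- The range of the variables is nonempty because `Pr` is always an allowed type.
  obtain ⟨N, rfl⟩ : ∃ N, n = N + 1 :=
    Nat.exists_eq_succ_of_ne_zero fun h => by
      subst h
      exact (e (.pos, ⟨⟨.pr, ⊤⟩, Types.pr_mem k m⟩)).elim0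
  -- Finitely many states with finite labels mention only finitely many propositions, so the lengths
  -- of their names are bounded.
  obtain ⟨B, hB⟩ : ∃ B, ∀ s, ∀ q ∈ T.label s, q.length < B := by
    have hf : (⋃ s, (T.label s : Set Name)).Finite :=
      Set.finite_iUnion fun s => (T.label s).finite_toSet
    obtain ⟨B, hB⟩ := (hf.image List.length).bddAbove
    exact ⟨B + 1, fun s q hq => Nat.lt_succ_of_le (hB ⟨q, Set.mem_iUnion.2 ⟨s, hq⟩, rfl⟩)⟩
  have hspec : ∀ s φ, (typedAlgebra T e.symm B).accept s
      (φ.toTerm.eval (typedAlgebra T e.symm B) []) = true ↔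
        φ ∈ Fragment A k m ∧ Satisfies T s φ := by
    intro s φ
    have h := fun d => isVal_eval (e := e.symm) hB φ true [] .pr d
    simp only [typedAlgebra, decide_eq_true_eq] at h ⊢
    simp only [h]
    exact ⟨fun ⟨d, ⟨ht, hs⟩, hd⟩ => ⟨ht, d, hs, hd⟩, fun ⟨ht, d, hs, hd⟩ => ⟨d, ⟨ht, hs⟩, hd⟩⟩
  refine inEXPTIME_of_algebra (typedAlgebra T e.symm B) _ ?_ fun s φ h => ?_
  · rintro w ⟨s, φ, rfl, h⟩
    exact ⟨s, φ, rfl, (hspec s φ).2 h⟩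
  · exact ⟨s, φ, rfl, (hspec s φ).1 h⟩

end HFL

theorem mainTheorem7 (k m : ℕ) (hk : 1 ≤ k) (hm : 1 ≤ m) {A S : Type} [Finite A] [Finite S]
    (T : HFL.LTS A S) : HFL.InEXPTIME (HFL.modelChecking T k m) := by
  exact HFL.inEXPTIME_modelChecking k m T
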